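/- Let $n\ge 1$ and let $\nu=\nu_1\times\cdots\times\nu_n$ be a product measure on $\mathbb{R}^n$ with $\mathrm{d}\nu_i(x)=f_i(x)\,\mathrm{d}x$, where each $f_i:\mathbb{R}\to[0,\infty)$ is radially decreasing, i.e. $f_i(tx)\le f_i(x)$ for all $x\in\mathbb{R}$ and $t\ge 1$, and has convex support $\{x\in\mathbb{R}: f_i(x)>0\}$. Write $f(x)=\prod_{i=1}^n f_i(x_i)$ for the density of $\nu$ and $\mathrm{supp} f=\{x\in\mathbb{R}^n:f(x)>0\}$. For $p>1$ with Hölder conjugate $q$ (that is, $1/p+1/q=1$), $c\ge 0$ and sets $A,B\subset\mathbb{R}^n$, put $c\cdot A=c^{1/p}A$ and $$A+_pB=\bigl\{(1-\mu)^{1/q}x+\mu^{1/q}y:\ x\in A,\ y\in B,\ \mu\in[0,1]\bigr\}.$$ A set $A\subset\mathbb{R}^n$ is called weakly unconditional if $(\epsilon_1x_1,\dots,\epsilon_nx_n)\in A$ for all $(x_1,\dots,x_n)\in A$ and all $(\epsilon_1,\dots,\epsilon_n)\in\{0,1\}^n$. Let $K,L\subset\mathbb{R}^n$ be weakly unconditional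 (Lebesgue) measurable sets with $\nu(K)\nu(L)>0$ such that $\lambda_1K+\lambda_2L$ is measurable for all $\lambda_1,\lambda_2\ge 0$ with $\lambda_1+\lambda_2\le 1$, and let $p>1$. Then, for all $\lambda\in(0,1)$ for which $(1-\lambda)\cdot K+_p\lambda\cdot L$ is measurable, $$\nu\bigl((1-\lambda)\cdot K+_p\lambda\cdot L\bigr)^{p/n}\ \ge\ (1-\lambda)\,\nu(K)^{p/n}+\lambda\,\nu(L)^{p/n},$$ where both sides may take the value $\infty$. Suppose in addition that $K$ and $L$ are convex bodies (nonempty compact convex sets) contained in $\mathrm{supp} f$ with $\nu(K),\nu(L)<\infty$, and that $f$ is strictly radially decreasing on $\mathrm{supp} f$, i.e. $f(tx)<f(x)$ whenever $t>1$, $x\neq 0$ and $x,tx\in\mathrm{supp} f$. Then, for every $p>1$ and every $\lambda\in(0,1)$, equality holds in the above inequality if and only if $K=L$. -/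

import Mathlib

open MeasureTheory
open scoped ENNReal NNReal Pointwise

/-- A set `A ⊆ ℝⁿ` is weakly unconditional if replacing any coordinates of a point of `A`
by zero gives again a point of `A`. -/
def WeaklyUnconditional {n : ℕ} (A : Set (Fin n → ℝ)) : Prop :=
  ∀ x ∈ A, ∀ ε : Fin n → ℝ, (∀ i, ε i = 0 ∨ ε i = 1) → (fun i => ε i * x i) ∈ A

/-- `f` is radially decreasing: `f (t x) ≤ f x` for all `x` and all `t ≥ 1`. -/
def RadiallyDecreasing {E : Type*} [AddCommGroup E] [Module ℝ E] (f : E → ℝ≥0) : Prop :=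
  ∀ (x : E) (t : ℝ), 1 ≤ t → f (t • x) ≤ f x

/-- `f` is strictly radially decreasing on its support `{f > 0}`: `f (t x) < f x` whenever `t > 1`
and both points `x`, `t x` are in the support. The point `x = 0`, where `t x = x`, is excluded. -/
def StrictlyRadiallyDecreasingOnSupport {E : Type*} [AddCommGroup E] [Module ℝ E]
    (f : E → ℝ≥0) : Prop :=
  ∀ (x : E) (t : ℝ), x ≠ 0 → 1 < t → 0 < f x → 0 < f (t • x) → f (t • x) < f x

/-- The `p`-scalar multiplication `c · K = c^(1/p) K`. -/
noncomputable def lpSMul {E : Type*} [AddCommGroup E] [Module ℝ E] (p c : ℝ) (K : Set E) : Set E :=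
  (c ^ (1 / p) : ℝ) • K

/-- The `p`-sum `K +_p L` of two sets, with `q` the Hölder conjugate of `p`. -/
def lpSum {E : Type*} [AddCommGroup E] [Module ℝ E] (p : ℝ) (K L : Set E) : Set E :=
  {z | ∃ x ∈ K, ∃ y ∈ L, ∃ μ ∈ Set.Icc (0 : ℝ) 1,
    z = ((1 - μ) ^ (1 / p.conjExponent) : ℝ) • x + (μ ^ (1 / p.conjExponent) : ℝ) • y}

/-- Convex bodies: nonempty compact convex sets. -/
def IsConvexBody {n : ℕ} (K : Set (Fin n → ℝ)) : Prop :=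
  K.Nonempty ∧ IsCompact K ∧ Convex ℝ K

/-- The product measure `ν₁ × ⋯ × νₙ` on `ℝⁿ` where `νᵢ` has the density `fᵢ`
with respect to Lebesgue measure on `ℝ`. -/
noncomputable def productMeasure {n : ℕ} (f : Fin n → ℝ → ℝ≥0) : Measure (Fin n → ℝ) :=
  Measure.pi fun i => (volume : Measure ℝ).withDensity fun x => (f i x : ℝ≥0∞)

/-- The product function `x ↦ f₁(x₁) ⋯ fₙ(xₙ)` on `ℝⁿ`, the density of the product measure. -/
def productDensity {n : ℕ} (f : Fin n → ℝ → ℝ≥0) (x : Fin n → ℝ) : ℝ≥0 :=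
  ∏ i, f i (x i)

/-!
The inequality rests on a linear version: if `a, b ≥ 0` and `a + b ≤ 1`, then
`a * ν(K) ^ (1 / n) + b * ν(L) ^ (1 / n) ≤ ν(a • K + b • L) ^ (1 / n)`
(`productMeasure_smul_add_smul`). On the line, it is the Brunn–Minkowski inequality for the
intersections with the superlevel sets of the density, which are intervals around the origin
(`RadiallyDecreasing.withDensity_le`) and therefore closed under combinations with weights of sum
at most `1`. The passage to `ℝⁿ` is by induction on slices: by weak unconditionality, the
slice through the origin contains all the others, so the measures of the slices, divided by that of
the central one, are functions with maximum `1` at the origin, for which the inequality on the line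
has a functional form (`RadiallyDecreasing.lintegral_le`); Jensen's inequality recombines the terms.
This is done for compact sets and finite measures. The general case follows by truncating the
densities and by inner regularity, because the weakly unconditional hull of a compact set is
compact.

The `p`-sum is the union over `μ` of the sets `a • K + b • L` with weights
`a = (1 - μ) ^ (1 / q) * (1 - λ) ^ (1 / p)` and `b = μ ^ (1 / q) * λ ^ (1 / p)`, and `a + b ≤ 1` by
Young's inequality. Choosing the `μ` for which Hölder's inequality is an equality turns the linear
inequality into the one with exponent `p / n` (`exists_lpWeight_eq`, `productMeasure_lpSum`).

Now suppose that equality holds. If `ν(K) ≠ ν(L)`, the optimal weights have sum `c < 1`, and the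
strict inequality `c ^ n * ν(M) < ν(c • M)` (`mul_productMeasure_lt_productMeasure_smul`) for
`M = (a / c) • K + (b / c) • L` gives a contradiction. If `ν(K) = ν(L)`, then already
`N = (1 - λ) • K + λ • L` has at least the measure of the `p`-sum, which is finite. Since the sets
`a • K + b • L` are convex with nonempty interior and `N` is closed, they all lie in `N`
(`Convex.volume_sdiff_ne_zero`). In terms of support functions, the `p`-th power mean of `h_K` and
`h_L` is at most their arithmetic mean, so `h_K = h_L` by strict convexity (`eq_of_lpSum_subset`).
-/

/-! ### The inequality on the line -/

/-- An inequality that is linear in two extended nonnegative reals follows from its instances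
at smaller values. The value `0` is admitted so that `x = 0` and `y = 0` are covered. -/
lemma ENNReal.mul_add_mul_le_of_forall_lt {a b x y z : ℝ≥0∞} (ha : a ≠ ∞) (hb : b ≠ ∞)
    (h : ∀ x' y', (x' < x ∨ x' = 0) → (y' < y ∨ y' = 0) → a * x' + b * y' ≤ z) :
    a * x + b * y ≤ z := by
  have key : ∀ x : ℝ≥0∞, ∃ l : Filter ℝ≥0∞, l.NeBot ∧ l ≤ nhds x ∧
      ∀ᶠ x' in l, x' < x ∨ x' = 0 := by
    intro x
    rcases eq_or_ne x 0 with rfl | hx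
    · exact ⟨pure 0, inferInstance, pure_le_nhds 0, by simp⟩
    · refine ⟨nhdsWithin x (Set.Iio x), ?_, nhdsWithin_le_nhds, ?_⟩
      · exact nhdsLT_neBot_of_exists_lt ⟨0, pos_iff_ne_zero.2 hx⟩
      · filter_upwards [self_mem_nhdsWithin] with x' hx'
        exact Or.inl hx'
  obtain ⟨l, hl, hlx, hl'⟩ := key x
  obtain ⟨m, hm, hmy, hm'⟩ := key y
  have h1 : Filter.Tendsto (fun w : ℝ≥0∞ × ℝ≥0∞ => a * w.1 + b * w.2) (l ×ˢ m)
      (nhds (a * x + b * y)) := by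
    refine Filter.Tendsto.add ?_ ?_
    · exact ((ENNReal.continuous_const_mul ha).tendsto x).comp
        (Filter.tendsto_fst.mono_right hlx)
    · exact ((ENNReal.continuous_const_mul hb).tendsto y).comp
        (Filter.tendsto_snd.mono_right hmy)
  refine le_of_tendsto h1 ?_
  filter_upwards [hl'.prod_mk hm'] with w hw
  exact h _ _ hw.1 hw.2

lemma Real.volume_add_le_of_isCompact {A B : Set ℝ} (hA : IsCompact A) (hB : IsCompact B)
    (hA' : A.Nonempty) (hB' : B.Nonempty) : volume A + volume B ≤ volume (A + B) := by
  obtain ⟨M, hM, hMA⟩ := hA.exists_isGreatest hA'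
  obtain ⟨m, hm, hmB⟩ := hB.exists_isLeast hB'
  -- the translates `A + m` and `M + B` of `A` and `B` lie on the two sides of `M + m`
  rw [← measure_inter_add_sdiff (A + B) (measurableSet_Iic (a := M + m))]
  refine add_le_add ?_ ?_
  · calc volume A = volume ((fun x => x + m) '' A) := by
          rw [Set.image_add_right, measure_preimage_add_right]
      _ ≤ _ := by
          refine measure_mono ?_
          rintro _ ⟨x, hx, rfl⟩
          exact ⟨Set.add_mem_add hx hm, by simpa using hMA hx⟩
  · calc volume B = volume ((fun x => M + x) '' B) := by
          rw [Set.image_add_left, measure_preimage_add]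
      _ = volume (((fun x => M + x) '' B) \ {M + m}) :=
          (measure_sdiff_null (measure_singleton _)).symm
      _ ≤ _ := by
          refine measure_mono ?_
          rintro _ ⟨⟨x, hx, rfl⟩, hx'⟩
          refine ⟨Set.add_mem_add hM hx, ?_⟩
          have h1 : m ≤ x := hmB hx
          have h2 : M + x ≠ M + m := hx'
          have h3 : x ≠ m := fun h => h2 (by rw [h])
          have h4 : m < x := lt_of_le_of_ne h1 h3.symm
          simpa using h4

/-- The Brunn–Minkowski inequality on the line. The sumset need not be measurable. -/
lemma Real.volume_add_le {A B : Set ℝ} (hA : MeasurableSet A) (hB : MeasurableSet B)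
    (hA' : A.Nonempty) (hB' : B.Nonempty) : volume A + volume B ≤ volume (A + B) := by
  have key : ∀ {A : Set ℝ}, MeasurableSet A → A.Nonempty → ∀ x, (x < volume A ∨ x = 0) →
      ∃ C ⊆ A, IsCompact C ∧ C.Nonempty ∧ x ≤ volume C := by
    rintro A hA ⟨a, ha⟩ x (hx | rfl)
    · obtain ⟨C, hCA, hC, hxC⟩ := hA.exists_lt_isCompact hx
      exact ⟨C, hCA, hC, nonempty_of_measure_ne_zero (ne_bot_of_gt hxC), hxC.le⟩
    · exact ⟨{a}, by simpa using ha, isCompact_singleton, by simp, zero_le⟩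
  have := ENNReal.mul_add_mul_le_of_forall_lt (a := 1) (b := 1) (x := volume A) (y := volume B)
    (z := volume (A + B)) (by simp) (by simp) ?_
  · simpa using this
  · intro x y hx hy
    obtain ⟨C, hCA, hC, hC', hxC⟩ := key hA hA' x hx
    obtain ⟨D, hDB, hD, hD', hyD⟩ := key hB hB' y hy
    simp only [one_mul]
    exact (add_le_add hxC hyD).trans ((Real.volume_add_le_of_isCompact hC hD hC' hD').trans
      (measure_mono (Set.add_subset_add hCA hDB)))

lemma Real.volume_smul_add_smul_le {A B : Set ℝ} (hA : MeasurableSet A) (hB : MeasurableSet B)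
    (hA' : A.Nonempty) (hB' : B.Nonempty) {a b : ℝ} (ha : 0 ≤ a) (hb : 0 ≤ b) :
    ENNReal.ofReal a * volume A + ENNReal.ofReal b * volume B ≤ volume (a • A + b • B) := by
  have := Real.volume_add_le (hA.const_smul₀ a) (hB.const_smul₀ b) hA'.smul_set hB'.smul_set
  simpa [Measure.addHaar_smul, abs_of_nonneg, ha, hb] using this

/-- The superlevel sets of a radially decreasing function on the line, with the origin added,
are intervals. -/
lemma RadiallyDecreasing.convex_insert_zero {f : ℝ → ℝ≥0} (hf : RadiallyDecreasing f)
    {P : ℝ≥0 → Prop} (hP : ∀ r s, r ≤ s → P r → P s) :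
    Convex ℝ (insert 0 {x | P (f x)}) := by
  have hstar : ∀ x ∈ insert (0 : ℝ) {x | P (f x)}, ∀ c ∈ Set.Icc (0 : ℝ) 1,
      c * x ∈ insert (0 : ℝ) {x | P (f x)} := by
    rintro x (rfl | hx) c ⟨hc0, hc1⟩
    · simp
    · rcases hc0.eq_or_lt with rfl | hc0
      · simp
      · right
        refine hP _ _ ?_ hx
        have := hf (c * x) c⁻¹ ((one_le_inv₀ hc0).2 hc1)
        rwa [smul_eq_mul, inv_mul_cancel_left₀ hc0.ne'] at this
  rw [convex_iff_ordConnected]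
  refine ⟨fun x hx y hy z hz => ?_⟩
  rcases le_total 0 z with h | h
  · rcases h.eq_or_lt with rfl | h
    · exact Set.mem_insert _ _
    · have hy0 : 0 < y := h.trans_le hz.2
      have := hstar y hy (z / y) ⟨by positivity, (div_le_one hy0).2 hz.2⟩
      rwa [div_mul_cancel₀ _ hy0.ne'] at this
  · rcases h.eq_or_lt with rfl | h
    · exact Set.mem_insert _ _
    · have hx0 : x < 0 := hz.1.trans_lt h
      have := hstar x hx (z / x) ⟨div_nonneg_of_nonpos h.le hx0.le,
        (div_le_one_of_neg hx0).2 hz.1⟩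
      rwa [div_mul_cancel₀ _ hx0.ne] at this

lemma RadiallyDecreasing.measurable {f : ℝ → ℝ≥0} (hf : RadiallyDecreasing f) :
    Measurable f := by
  refine measurable_of_Ioi fun r => ?_
  have h1 : MeasurableSet (insert 0 {x | r < f x}) :=
    (hf.convex_insert_zero (P := fun s => r < s) fun _ _ hrs h => h.trans_le hrs).ordConnected
      |>.measurableSet
  by_cases h0 : r < f 0
  · rwa [Set.insert_eq_of_mem (by exact h0)] at h1
  · have h2 : f ⁻¹' Set.Ioi r = insert 0 {x | r < f x} \ {0} := by
      ext x
      by_cases hx : x = 0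
      · simp [hx, h0]
      · simp [hx]
    rw [h2]
    exact h1.diff (measurableSet_singleton 0)

/-- A convex set containing the origin is closed under subconvex combinations. -/
lemma Convex.smul_add_smul_mem_of_zero_mem {E : Type*} [AddCommGroup E] [Module ℝ E] {C : Set E}
    (hC : Convex ℝ C) (h0 : (0 : E) ∈ C) {x y : E} (hx : x ∈ C) (hy : y ∈ C) {a b : ℝ}
    (ha : 0 ≤ a) (hb : 0 ≤ b) (hab : a + b ≤ 1) : a • x + b • y ∈ C := by
  rcases (add_nonneg ha hb).eq_or_lt with h | h
  · have h1 : a = 0 := by linarith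
    have h2 : b = 0 := by linarith
    simpa [h1, h2] using h0
  · have h1 := hC hx hy (a := a / (a + b)) (b := b / (a + b)) (by positivity) (by positivity)
      (by field_simp)
    have h2 := starConvex_zero_iff.1 (hC.starConvex h0) h1 h.le hab
    rwa [smul_add, smul_smul, smul_smul, mul_div_cancel₀ _ h.ne', mul_div_cancel₀ _ h.ne'] at h2

/-- The linear Brunn–Minkowski inequality for a radially decreasing density on the line: apply
the Lebesgue inequality to the intersections with each superlevel set of the density. -/
lemma RadiallyDecreasing.withDensity_le {f : ℝ → ℝ≥0} (hf : RadiallyDecreasing f)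
    {A B E : Set ℝ} (hA : MeasurableSet A) (hB : MeasurableSet B) (hE : MeasurableSet E)
    (hA0 : 0 ∈ A) (hB0 : 0 ∈ B) {a b : ℝ} (ha : 0 ≤ a) (hb : 0 ≤ b) (hab : a + b ≤ 1)
    (hABE : a • A + b • B ⊆ E) :
    ENNReal.ofReal a * (volume.withDensity fun x => (f x : ℝ≥0∞)) A
      + ENNReal.ofReal b * (volume.withDensity fun x => (f x : ℝ≥0∞)) B
      ≤ (volume.withDensity fun x => (f x : ℝ≥0∞)) E := by
  have hfm : Measurable fun x => (f x : ℝ) := hf.measurable.coe_nnreal_real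
  have hlev : ∀ t : ℝ, MeasurableSet {x | t ≤ (f x : ℝ)} := fun t =>
    measurableSet_le measurable_const hfm
  have layer : ∀ {S : Set ℝ}, MeasurableSet S →
      (volume.withDensity fun x => (f x : ℝ≥0∞)) S
        = ∫⁻ t in Set.Ioi (0 : ℝ), volume ({x | t ≤ (f x : ℝ)} ∩ S) := by
    intro S hS
    have := lintegral_eq_lintegral_meas_le (volume.restrict S) (f := fun x => (f x : ℝ))
      (Filter.Eventually.of_forall fun x => (f x).2) hfm.aemeasurable
    simp only [ENNReal.ofReal_coe_nnreal, Measure.restrict_apply (hlev _)] at this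
    rw [withDensity_apply _ hS, this]
  rw [layer hA, layer hB, layer hE]
  refine (add_le_add (lintegral_const_mul_le _ _) (lintegral_const_mul_le _ _)).trans
    ((le_lintegral_add _ _).trans (lintegral_mono fun t => ?_))
  set T : Set ℝ := insert 0 {x | t ≤ (f x : ℝ)} with hT
  have hTconv : Convex ℝ T := hf.convex_insert_zero (P := fun s => t ≤ (s : ℝ))
    fun r s hrs h => h.trans (NNReal.coe_le_coe.2 hrs)
  have hTm : MeasurableSet T := (hlev t).insert 0
  have hT0 : (0 : ℝ) ∈ T := Set.mem_insert _ _
  have hins : ∀ S : Set ℝ, volume (T ∩ S) = volume ({x | t ≤ (f x : ℝ)} ∩ S) := by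
    intro S
    refine le_antisymm ?_ (measure_mono (Set.inter_subset_inter_left _ (Set.subset_insert _ _)))
    refine (measure_mono (t := insert 0 ({x | t ≤ (f x : ℝ)} ∩ S)) ?_).trans_eq
      (measure_congr (insert_ae_eq_self _ _))
    rintro x ⟨rfl | hx, hxS⟩
    · exact Set.mem_insert _ _
    · exact Or.inr ⟨hx, hxS⟩
  simp only [← hins]
  refine (Real.volume_smul_add_smul_le (hTm.inter hA) (hTm.inter hB) ⟨0, hT0, hA0⟩
    ⟨0, hT0, hB0⟩ ha hb).trans (measure_mono ?_)
  rintro _ ⟨_, ⟨x, hx, rfl⟩, _, ⟨y, hy, rfl⟩, rfl⟩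
  refine ⟨?_, hABE (Set.add_mem_add (Set.smul_mem_smul_set hx.2) (Set.smul_mem_smul_set hy.2))⟩
  exact hTconv.smul_add_smul_mem_of_zero_mem hT0 hx.1 hy.1 ha hb hab

/-- The functional form of the inequality on the line, for functions with maximum `1` at the
origin: apply the inequality for sets to the superlevel sets of `F`, `G` and `H`. -/
lemma RadiallyDecreasing.lintegral_le {f : ℝ → ℝ≥0} (hf : RadiallyDecreasing f)
    {F G H : ℝ → ℝ} (hF : Measurable F) (hG : Measurable G) (hH : Measurable H)
    (hFnn : 0 ≤ F) (hGnn : 0 ≤ G) (hHnn : 0 ≤ H)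
    (hF0 : F 0 = 1) (hG0 : G 0 = 1) (hF1 : ∀ x, F x ≤ 1) (hG1 : ∀ x, G x ≤ 1)
    {a b : ℝ} (ha : 0 ≤ a) (hb : 0 ≤ b) (hab : a + b ≤ 1)
    (hFGH : ∀ s, 0 < s → s ≤ 1 → ∀ x y, s ≤ F x → s ≤ G y → s ≤ H (a * x + b * y)) :
    ENNReal.ofReal a * ∫⁻ x, ENNReal.ofReal (F x) ∂(volume.withDensity fun x => (f x : ℝ≥0∞))
      + ENNReal.ofReal b * ∫⁻ x, ENNReal.ofReal (G x) ∂(volume.withDensity fun x => (f x : ℝ≥0∞))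
      ≤ ∫⁻ x, ENNReal.ofReal (H x) ∂(volume.withDensity fun x => (f x : ℝ≥0∞)) := by
  set ν : Measure ℝ := volume.withDensity fun x => (f x : ℝ≥0∞) with hν
  rw [lintegral_eq_lintegral_meas_le ν (.of_forall hFnn) hF.aemeasurable,
    lintegral_eq_lintegral_meas_le ν (.of_forall hGnn) hG.aemeasurable,
    lintegral_eq_lintegral_meas_le ν (.of_forall hHnn) hH.aemeasurable]
  refine (add_le_add (lintegral_const_mul_le _ _) (lintegral_const_mul_le _ _)).trans
    ((le_lintegral_add _ _).trans (setLIntegral_mono' measurableSet_Ioi fun t ht => ?_))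
  have ht : 0 < t := ht
  by_cases ht1 : t ≤ 1
  · refine hf.withDensity_le (measurableSet_le measurable_const hF)
      (measurableSet_le measurable_const hG) (measurableSet_le measurable_const hH)
      (by simpa [hF0] using ht1) (by simpa [hG0] using ht1) ha hb hab ?_
    rintro _ ⟨_, ⟨x, hx, rfl⟩, _, ⟨y, hy, rfl⟩, rfl⟩
    exact hFGH t ht ht1 x y hx hy
  · have hempty : ∀ {F : ℝ → ℝ}, (∀ x, F x ≤ 1) → {x | t ≤ F x} = ∅ := by
      intro F hF1
      ext x
      simpa using (hF1 x).trans_lt (not_le.1 ht1)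
    simp [hempty hF1, hempty hG1]

/-! ### Product measures and their slices -/

lemma sigmaFinite_volume_withDensity_nnreal (f : ℝ → ℝ≥0) :
    SigmaFinite ((volume : Measure ℝ).withDensity fun x => (f x : ℝ≥0∞)) :=
  SigmaFinite.withDensity_of_ne_top' fun _ => ENNReal.coe_ne_top

lemma productMeasure_apply_eq_lintegral_slice {n : ℕ} {f : Fin (n + 1) → ℝ → ℝ≥0}
    {A : Set (Fin (n + 1) → ℝ)} (hA : MeasurableSet A) :
    productMeasure f A = ∫⁻ t, productMeasure (fun j : Fin n => f j.succ)
      {x | (Fin.cons t x : Fin (n + 1) → ℝ) ∈ A} ∂(volume.withDensity fun x => (f 0 x : ℝ≥0∞)) := by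
  have := fun i => sigmaFinite_volume_withDensity_nnreal (f i)
  have h1 := (measurePreserving_piFinSuccAbove (fun i : Fin (n + 1) =>
    (volume : Measure ℝ).withDensity fun x => (f i x : ℝ≥0∞)) 0).symm
  have h2 := h1.measure_preimage_equiv A
  rw [productMeasure, ← h2, Measure.prod_apply (MeasurableEquiv.measurable _ hA)]
  refine lintegral_congr fun t => ?_
  simp only [productMeasure, Fin.zero_succAbove]
  congr 1
  ext x
  simp [MeasurableEquiv.piFinSuccAbove_symm_apply, Fin.insertNthEquiv]

lemma measurable_productMeasure_slice {n : ℕ} {f : Fin n → ℝ → ℝ≥0}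
    {A : Set (Fin (n + 1) → ℝ)} (hA : MeasurableSet A) :
    Measurable fun t : ℝ => productMeasure f {x | (Fin.cons t x : Fin (n + 1) → ℝ) ∈ A} := by
  have := fun i => sigmaFinite_volume_withDensity_nnreal (f i)
  have h := (MeasurableEquiv.piFinSuccAbove (fun _ : Fin (n + 1) => ℝ) 0).symm.measurable hA
  have : SigmaFinite (productMeasure f) := by unfold productMeasure; infer_instance
  convert measurable_measure_prodMk_left (ν := productMeasure f) h using 3
  ext x
  simp [MeasurableEquiv.piFinSuccAbove_symm_apply, Fin.insertNthEquiv]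

lemma isCompact_slice {n : ℕ} {A : Set (Fin (n + 1) → ℝ)} (hA : IsCompact A) (t : ℝ) :
    IsCompact {x : Fin n → ℝ | (Fin.cons t x : Fin (n + 1) → ℝ) ∈ A} := by
  have h1 : IsCompact (A ∩ {x | x 0 = t}) :=
    hA.inter_right (isClosed_eq (continuous_apply 0) continuous_const)
  have h2 : Continuous fun x : Fin (n + 1) → ℝ => (Fin.tail x : Fin n → ℝ) :=
    continuous_pi fun i => continuous_apply i.succ
  convert h1.image h2 using 1
  ext x
  constructor
  · intro hx
    exact ⟨Fin.cons t x, ⟨hx, by simp⟩, by simp⟩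
  · rintro ⟨y, ⟨hy, rfl⟩, rfl⟩
    simpa using hy

lemma WeaklyUnconditional.slice {n : ℕ} {A : Set (Fin (n + 1) → ℝ)} (hA : WeaklyUnconditional A)
    (t : ℝ) : WeaklyUnconditional {x : Fin n → ℝ | (Fin.cons t x : Fin (n + 1) → ℝ) ∈ A} := by
  intro x hx ε hε
  have := hA _ hx (Fin.cons 1 ε) (Fin.cases (by simp) fun i => by simpa using hε i)
  rw [Set.mem_ofPred_eq]
  convert this using 1
  ext i
  refine Fin.cases ?_ (fun j => ?_) i <;> simp

/-- All slices of a weakly unconditional set are contained in the slice through the origin. -/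
lemma WeaklyUnconditional.slice_subset {n : ℕ} {A : Set (Fin (n + 1) → ℝ)}
    (hA : WeaklyUnconditional A) (t : ℝ) :
    {x : Fin n → ℝ | (Fin.cons t x : Fin (n + 1) → ℝ) ∈ A}
      ⊆ {x | (Fin.cons 0 x : Fin (n + 1) → ℝ) ∈ A} := by
  intro x hx
  have := hA _ hx (Fin.cons 0 1) (Fin.cases (by simp) fun i => by simp)
  rw [Set.mem_ofPred_eq]
  convert this using 1
  ext i
  refine Fin.cases ?_ (fun j => ?_) i <;> simp

lemma WeaklyUnconditional.zero_mem {n : ℕ} {A : Set (Fin n → ℝ)} (hA : WeaklyUnconditional A)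
    (hne : A.Nonempty) : (0 : Fin n → ℝ) ∈ A := by
  obtain ⟨x, hx⟩ := hne
  convert hA x hx 0 (fun i => Or.inl rfl) using 1
  ext i
  simp

lemma slice_smul_add_smul {n : ℕ} (A B : Set (Fin (n + 1) → ℝ)) (a b s t : ℝ) :
    a • {x : Fin n → ℝ | (Fin.cons s x : Fin (n + 1) → ℝ) ∈ A}
        + b • {x : Fin n → ℝ | (Fin.cons t x : Fin (n + 1) → ℝ) ∈ B}
      ⊆ {x | (Fin.cons (a * s + b * t) x : Fin (n + 1) → ℝ) ∈ a • A + b • B} := by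
  rintro _ ⟨_, ⟨x, hx, rfl⟩, _, ⟨y, hy, rfl⟩, rfl⟩
  refine ⟨_, ⟨_, hx, rfl⟩, _, ⟨_, hy, rfl⟩, ?_⟩
  ext i
  refine Fin.cases ?_ (fun j => ?_) i <;> simp

/-! ### The linear inequality for finite product measures -/

/-- Jensen's inequality for `r ↦ r ^ (n + 1)` at `x / v` and `y / w`, with weights proportional
to `a * v` and `b * w`. -/
lemma add_pow_succ_le_mul_add_div_pow (n : ℕ) {a b v w x y : ℝ} (ha : 0 ≤ a) (hb : 0 ≤ b)
    (hv : 0 < v) (hw : 0 < w) (hx : 0 ≤ x) (hy : 0 ≤ y) :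
    (a * x + b * y) ^ (n + 1)
      ≤ (a * v + b * w) ^ n * (a * (x ^ (n + 1) / v ^ n) + b * (y ^ (n + 1) / w ^ n)) := by
  rcases (by positivity : 0 ≤ a * v + b * w).eq_or_lt with h | h
  · have h1 : a * v = 0 := by nlinarith [mul_nonneg ha hv.le, mul_nonneg hb hw.le]
    have h2 : b * w = 0 := by nlinarith [mul_nonneg ha hv.le, mul_nonneg hb hw.le]
    have h3 : a = 0 := by simpa [hv.ne'] using h1
    have h4 : b = 0 := by simpa [hw.ne'] using h2
    simp [h3, h4]
  · have key := (convexOn_pow (n + 1) : ConvexOn ℝ (Set.Ici 0) fun r : ℝ => r ^ (n + 1)).2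
      (div_nonneg hx hv.le : (0 : ℝ) ≤ x / v) (div_nonneg hy hw.le : (0 : ℝ) ≤ y / w)
      (by positivity : 0 ≤ a * v / (a * v + b * w)) (by positivity : 0 ≤ b * w / (a * v + b * w))
      (by field_simp)
    simp only [smul_eq_mul] at key
    have e1 : a * v / (a * v + b * w) * (x / v) + b * w / (a * v + b * w) * (y / w)
        = (a * x + b * y) / (a * v + b * w) := by field_simp
    have e2 : a * v / (a * v + b * w) * (x / v) ^ (n + 1)
          + b * w / (a * v + b * w) * (y / w) ^ (n + 1)
        = (a * (x ^ (n + 1) / v ^ n) + b * (y ^ (n + 1) / w ^ n)) / (a * v + b * w) := by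
      simp only [div_pow, pow_succ]; field_simp
    rw [e1, e2, div_pow, div_le_iff₀ (by positivity)] at key
    refine key.trans_eq ?_
    field_simp; ring

/-- An `n`-th root of `s`, where for `n = 0` the condition is weakened to `s ≤ r ^ 0 = 1`. -/
lemma exists_pow_eq_of_ne_zero (n : ℕ) {s : ℝ} (hs : 0 < s) (hs1 : s ≤ 1) :
    ∃ r : ℝ, 0 < r ∧ s ≤ r ^ n ∧ (n ≠ 0 → r ^ n = s) := by
  rcases eq_or_ne n 0 with rfl | hn
  · exact ⟨1, one_pos, by simpa using hs1, by simp⟩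
  · have h := Real.rpow_inv_natCast_pow hs.le hn
    exact ⟨s ^ (n⁻¹ : ℝ), by positivity, h.ge, fun _ => h⟩

lemma productMeasure_eq_one_of_dim_zero (f : Fin 0 → ℝ → ℝ≥0) {S : Set (Fin 0 → ℝ)}
    (hS : S.Nonempty) : productMeasure f S = 1 := by
  obtain ⟨x, hx⟩ := hS
  rw [productMeasure, Measure.pi_of_empty _ x, Measure.dirac_apply_of_mem hx]

/-- The linear inequality for compact sets and finite measures, by induction on the dimension.
The induction hypothesis bounds the measures of the slices of the combination, and the functional
inequality on the line, applied to these measures divided by those of the slices at the origin,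
integrates the bound. Roots are avoided by taking `x ^ n` and `y ^ n` as lower bounds for the
measures. -/
theorem productMeasure_smul_add_smul_of_isCompact {n : ℕ} {f : Fin n → ℝ → ℝ≥0}
    (hf : ∀ i, RadiallyDecreasing (f i)) (hfin : ∀ i, ∫⁻ x, (f i x : ℝ≥0∞) ≠ ∞)
    {A B : Set (Fin n → ℝ)} (hA : IsCompact A) (hB : IsCompact B)
    (hAu : WeaklyUnconditional A) (hBu : WeaklyUnconditional B)
    {a b : ℝ} (ha : 0 ≤ a) (hb : 0 ≤ b) (hab : a + b ≤ 1) {x y : ℝ} (hx : 0 < x) (hy : 0 < y)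
    (hxA : ENNReal.ofReal (x ^ n) ≤ productMeasure f A)
    (hyB : ENNReal.ofReal (y ^ n) ≤ productMeasure f B) :
    ENNReal.ofReal ((a * x + b * y) ^ n) ≤ productMeasure f (a • A + b • B) := by
  induction n generalizing x y with
  | zero =>
    have hne : ∀ {S : Set (Fin 0 → ℝ)} {r : ℝ}, ENNReal.ofReal (r ^ 0) ≤ productMeasure f S →
        S.Nonempty := fun h =>
      nonempty_of_measure_ne_zero (ne_bot_of_gt ((by simp : (0 : ℝ≥0∞) < _).trans_le h))
    rw [productMeasure_eq_one_of_dim_zero f ((hne hxA).smul_set.add (hne hyB).smul_set)]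
    simp
  | succ n ih =>
    rcases (add_nonneg ha hb).eq_or_lt with h0 | h0
    · have h1 : a = 0 := by linarith
      have h2 : b = 0 := by linarith
      simp [h1, h2]
    have hC : IsCompact (a • A + b • B) := (hA.smul a).add (hB.smul b)
    set g : Fin n → ℝ → ℝ≥0 := fun j => f j.succ with hg
    have hgrad : ∀ i, RadiallyDecreasing (g i) := fun i => hf i.succ
    have hgfin : ∀ S, productMeasure g S ≠ ∞ := by
      have : ∀ i, IsFiniteMeasure ((volume : Measure ℝ).withDensity fun x => (g i x : ℝ≥0∞)) :=
        fun i => isFiniteMeasure_withDensity (hfin i.succ)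
      intro S
      unfold productMeasure
      exact measure_ne_top _ _
    -- the measures of the slices of a set at height `t`, and the measure of the slice at `0`
    let m : Set (Fin (n + 1) → ℝ) → ℝ → ℝ := fun A t =>
      (productMeasure g {x | (Fin.cons t x : Fin (n + 1) → ℝ) ∈ A}).toReal
    have hm : ∀ A t, productMeasure g {x | (Fin.cons t x : Fin (n + 1) → ℝ) ∈ A}
        = ENNReal.ofReal (m A t) := fun A t => (ENNReal.ofReal_toReal (hgfin _)).symm
    have hmnn : ∀ A t, 0 ≤ m A t := fun A t => ENNReal.toReal_nonneg
    have hmmeas : ∀ {A}, IsCompact A → Measurable (m A) := fun hA =>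
      (measurable_productMeasure_slice hA.measurableSet).ennreal_toReal
    have hmle : ∀ {A}, WeaklyUnconditional A → ∀ t, m A t ≤ m A 0 := fun hA t =>
      ENNReal.toReal_mono (hgfin _) (measure_mono (hA.slice_subset t))
    have hint : ∀ {A}, IsCompact A → ∀ {c : ℝ}, 0 < c → productMeasure f A
        = ENNReal.ofReal c * ∫⁻ t, ENNReal.ofReal (m A t / c)
            ∂(volume.withDensity fun x => (f 0 x : ℝ≥0∞)) := by
      intro A hA c hc
      rw [productMeasure_apply_eq_lintegral_slice hA.measurableSet,
        ← lintegral_const_mul _ ((hmmeas hA).div_const c).ennreal_ofReal]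
      refine lintegral_congr fun t => ?_
      rw [hm, ← ENNReal.ofReal_mul hc.le, mul_div_cancel₀ _ hc.ne']
    have hm0 : ∀ {A}, WeaklyUnconditional A → IsCompact A → ∀ {x : ℝ}, 0 < x →
        ENNReal.ofReal (x ^ (n + 1)) ≤ productMeasure f A → 0 < m A 0 := by
      intro A hAu hA x hx hxA
      refine (hmnn A 0).lt_of_ne' fun h => ?_
      have h1 : ∀ t, m A t = 0 := fun t => le_antisymm ((hmle hAu t).trans h.le) (hmnn A t)
      rw [hint hA one_pos] at hxA
      have : 0 < x ^ (n + 1) := by positivity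
      simp [h1] at hxA
      linarith
    have hV := hm0 hAu hA hx hxA
    have hW := hm0 hBu hB hy hyB
    -- an `n`-th root of the measure of the slice at `0`; if `n = 0`, this measure is `1`
    have hroot : ∀ {A}, 0 < m A 0 → ∃ v, 0 < v ∧ v ^ n = m A 0 := by
      intro A hV
      rcases eq_or_ne n 0 with rfl | hn
      · refine ⟨1, one_pos, ?_⟩
        have hne : {x : Fin 0 → ℝ | (Fin.cons 0 x : Fin 1 → ℝ) ∈ A}.Nonempty := by
          refine nonempty_of_measure_ne_zero (μ := productMeasure g) ?_
          rw [hm]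
          simpa using hV
        simp [m, productMeasure_eq_one_of_dim_zero g hne]
      · exact ⟨m A 0 ^ (n⁻¹ : ℝ), by positivity, Real.rpow_inv_natCast_pow hV.le hn⟩
    obtain ⟨v, hv, hvV⟩ := hroot hV
    obtain ⟨w, hw, hwW⟩ := hroot hW
    have hlevel : ∀ {A} {v : ℝ}, 0 < v → v ^ n = m A 0 → ∀ {s r : ℝ}, 0 < s →
        (n ≠ 0 → r ^ n = s) → ∀ {t}, s ≤ m A t / m A 0 → ENNReal.ofReal ((r * v) ^ n)
          ≤ productMeasure g {x | (Fin.cons t x : Fin (n + 1) → ℝ) ∈ A} := by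
      intro A v hv hvV s r hs hr t hst
      have hV : 0 < m A 0 := hvV ▸ pow_pos hv n
      rw [le_div_iff₀ hV] at hst
      rcases eq_or_ne n 0 with rfl | hn
      · have hne : {x : Fin 0 → ℝ | (Fin.cons t x : Fin 1 → ℝ) ∈ A}.Nonempty := by
          refine nonempty_of_measure_ne_zero (μ := productMeasure g) ?_
          rw [hm]
          simpa using (mul_pos hs hV).trans_le hst
        rw [productMeasure_eq_one_of_dim_zero g hne]
        simp
      · rw [hm, mul_pow, hr hn, hvV]
        exact ENNReal.ofReal_le_ofReal hst
    have hq : 0 < a * v + b * w := by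
      rcases ha.eq_or_lt with rfl | ha
      · have : 0 < b := by linarith
        positivity
      · positivity
    have hQ : 0 < (a * v + b * w) ^ n := by positivity
    have key := (hf 0).lintegral_le (F := fun t => m A t / m A 0) (G := fun t => m B t / m B 0)
      (H := fun t => m (a • A + b • B) t / (a * v + b * w) ^ n)
      ((hmmeas hA).div_const _) ((hmmeas hB).div_const _) ((hmmeas hC).div_const _)
      (fun t => div_nonneg (hmnn _ _) (hmnn _ _)) (fun t => div_nonneg (hmnn _ _) (hmnn _ _))
      (fun t => div_nonneg (hmnn _ _) hQ.le) (div_self hV.ne') (div_self hW.ne')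
      (fun t => div_le_one_of_le₀ (hmle hAu t) hV.le)
      (fun t => div_le_one_of_le₀ (hmle hBu t) hW.le) ha hb hab ?_
    · have hdiv : ∀ {A}, IsCompact A → 0 < m A 0 → ∀ {x : ℝ},
          ENNReal.ofReal x ≤ productMeasure f A → ENNReal.ofReal (x / m A 0)
            ≤ ∫⁻ t, ENNReal.ofReal (m A t / m A 0)
                ∂(volume.withDensity fun x => (f 0 x : ℝ≥0∞)) := by
        intro A hA hV x hx
        rw [hint hA hV, mul_comm] at hx
        rw [ENNReal.ofReal_div_of_pos hV]
        exact ENNReal.div_le_of_le_mul hx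
      have h1 := hdiv hA hV hxA
      have h2 := hdiv hB hW hyB
      rw [hint hC hQ]
      refine le_trans ?_ (mul_le_mul_right ((add_le_add (mul_le_mul_right h1 _)
        (mul_le_mul_right h2 _)).trans key) _)
      rw [← ENNReal.ofReal_mul ha, ← ENNReal.ofReal_mul hb,
        ← ENNReal.ofReal_add (by positivity) (by positivity), ← ENNReal.ofReal_mul hQ.le,
        ← hvV, ← hwW]
      exact ENNReal.ofReal_le_ofReal
        (add_pow_succ_le_mul_add_div_pow n ha hb hv hw hx.le hy.le)
    · intro s hs hs1 t u hst hsu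
      obtain ⟨r, hr, hsr, hrs⟩ := exists_pow_eq_of_ne_zero n hs hs1
      rw [le_div_iff₀ hQ]
      have h1 := ih hgrad (fun i => hfin i.succ) (isCompact_slice hA t) (isCompact_slice hB u)
        (hAu.slice t) (hBu.slice u) (mul_pos hr hv) (mul_pos hr hw) (hlevel hv hvV hs hrs hst)
        (hlevel hw hwW hs hrs hsu)
      have h2 := h1.trans (measure_mono (slice_smul_add_smul A B a b t u))
      rw [hm, ENNReal.ofReal_le_ofReal_iff (hmnn _ _)] at h2
      refine le_trans ?_ h2
      calc s * (a * v + b * w) ^ n ≤ r ^ n * (a * v + b * w) ^ n := by gcongr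
        _ = (a * (r * v) + b * (r * w)) ^ n := by rw [← mul_pow]; ring

/-! ### Densities of product measures and truncation -/

lemma lintegral_fin_prod_eq_prod_lintegral {n : ℕ} {g : Fin n → ℝ → ℝ≥0∞}
    (hg : ∀ i, Measurable (g i)) :
    ∫⁻ x : Fin n → ℝ, ∏ i, g i (x i) = ∏ i, ∫⁻ x, g i x := by
  induction n with
  | zero => simp [volume_pi]
  | succ n ih =>
    rw [← (volume_preserving_piFinSuccAbove (fun _ : Fin (n + 1) => ℝ) 0).symm.lintegral_comp_emb
      (MeasurableEquiv.measurableEmbedding _), Fin.prod_univ_succ, ← ih fun i => hg i.succ,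
      ← lintegral_prod_mul (g := fun y : Fin n → ℝ => ∏ i, g i.succ (y i)) (hg 0).aemeasurable
        (Finset.measurable_prod _ fun i _ => (hg _).comp (measurable_pi_apply i)).aemeasurable]
    refine lintegral_congr fun x => ?_
    simp [Fin.prod_univ_succ, MeasurableEquiv.piFinSuccAbove_symm_apply, Fin.insertNthEquiv]

lemma measurable_productDensity {n : ℕ} {f : Fin n → ℝ → ℝ≥0} (hf : ∀ i, Measurable (f i)) :
    Measurable (productDensity f) :=
  Finset.measurable_prod _ fun i _ => (hf i).comp (measurable_pi_apply i)

lemma productMeasure_eq_withDensity {n : ℕ} {f : Fin n → ℝ → ℝ≥0}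
    (hf : ∀ i, Measurable (f i)) :
    productMeasure f = volume.withDensity fun x => (productDensity f x : ℝ≥0∞) := by
  have := fun i => sigmaFinite_volume_withDensity_nnreal (f i)
  refine Measure.pi_eq fun s hs => ?_
  rw [withDensity_apply _ (MeasurableSet.univ_pi hs), ← lintegral_indicator (.univ_pi hs)]
  have h : ∀ i, (volume.withDensity fun x => (f i x : ℝ≥0∞)) (s i)
      = ∫⁻ x, (s i).indicator (fun x => (f i x : ℝ≥0∞)) x := fun i => by
    rw [withDensity_apply _ (hs i), lintegral_indicator (hs i)]
  rw [Finset.prod_congr rfl fun i _ => h i, ← lintegral_fin_prod_eq_prod_lintegral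
    fun i => (hf i).coe_nnreal_ennreal.indicator (hs i)]
  refine lintegral_congr fun x => ?_
  by_cases hx : x ∈ Set.univ.pi s
  · rw [Set.indicator_of_mem hx, productDensity, ENNReal.ofNNReal_finsetProd]
    exact Finset.prod_congr rfl fun i _ => (Set.indicator_of_mem (hx i trivial)
      fun x => (f i x : ℝ≥0∞)).symm
  · rw [Set.indicator_of_notMem hx]
    obtain ⟨i, hi⟩ : ∃ i, x i ∉ s i := by simpa using hx
    exact (Finset.prod_eq_zero (Finset.mem_univ i) (Set.indicator_of_notMem hi _)).symm

/-- The function `min f M` cut off outside `[-M, M]`. -/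
noncomputable def truncation (f : ℝ → ℝ≥0) (M : ℕ) (x : ℝ) : ℝ≥0 :=
  if |x| ≤ M then min (f x) M else 0

lemma truncation_le (f : ℝ → ℝ≥0) (M : ℕ) (x : ℝ) : truncation f M x ≤ f x := by
  unfold truncation
  split_ifs
  · exact min_le_left _ _
  · exact zero_le

lemma truncation_mono (f : ℝ → ℝ≥0) (x : ℝ) : Monotone fun M => truncation f M x := by
  intro M N hMN
  have h : (M : ℝ) ≤ N := by exact_mod_cast hMN
  have h' : (M : ℝ≥0) ≤ N := by exact_mod_cast hMN
  simp only [truncation]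
  by_cases hx : |x| ≤ M
  · rw [if_pos hx, if_pos (hx.trans h)]
    exact min_le_min_left _ h'
  · rw [if_neg hx]
    exact zero_le

lemma eventually_truncation_eq (f : ℝ → ℝ≥0) (x : ℝ) :
    ∀ᶠ M in Filter.atTop, truncation f M x = f x := by
  obtain ⟨N, hN⟩ := exists_nat_ge |x|
  obtain ⟨N', hN'⟩ := exists_nat_ge (f x)
  filter_upwards [Filter.eventually_ge_atTop N, Filter.eventually_ge_atTop N'] with M hM hM'
  have h1 : |x| ≤ M := hN.trans (by exact_mod_cast hM)
  have h2 : f x ≤ M := hN'.trans (by exact_mod_cast hM')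
  rw [truncation, if_pos h1, min_eq_left h2]

lemma RadiallyDecreasing.truncation {f : ℝ → ℝ≥0} (hf : RadiallyDecreasing f) (M : ℕ) :
    RadiallyDecreasing (truncation f M) := by
  intro x t ht
  have hx : |x| ≤ |t • x| := by
    rw [smul_eq_mul, abs_mul]
    exact le_mul_of_one_le_left (abs_nonneg x) (ht.trans (le_abs_self t))
  unfold _root_.truncation
  by_cases h : |t • x| ≤ M
  · rw [if_pos h, if_pos (hx.trans h)]
    exact min_le_min_right _ (hf x t ht)
  · rw [if_neg h]
    exact zero_le

lemma lintegral_truncation_ne_top (f : ℝ → ℝ≥0) (M : ℕ) :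
    ∫⁻ x, (truncation f M x : ℝ≥0∞) ≠ ∞ := by
  have h : ∀ x, (truncation f M x : ℝ≥0∞)
      ≤ (Set.Icc (-(M : ℝ)) M).indicator (fun _ => ((M : ℝ≥0) : ℝ≥0∞)) x := by
    intro x
    unfold truncation
    by_cases hx : |x| ≤ M
    · rw [if_pos hx, Set.indicator_of_mem (Set.mem_Icc.2 (abs_le.1 hx))]
      exact ENNReal.coe_le_coe.2 (min_le_right _ _)
    · simp [hx]
  refine ne_top_of_le_ne_top ?_ (lintegral_mono h)
  rw [lintegral_indicator measurableSet_Icc, setLIntegral_const]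
  exact ENNReal.mul_ne_top ENNReal.coe_ne_top (by simp)

lemma productMeasure_truncation_le {n : ℕ} {f : Fin n → ℝ → ℝ≥0}
    (hf : ∀ i, RadiallyDecreasing (f i)) (M : ℕ) (S : Set (Fin n → ℝ)) :
    productMeasure (fun i => truncation (f i) M) S ≤ productMeasure f S := by
  rw [productMeasure_eq_withDensity fun i => (hf i).measurable,
    productMeasure_eq_withDensity fun i => ((hf i).truncation M).measurable]
  refine withDensity_mono (.of_forall fun x => ENNReal.coe_le_coe.2 ?_) S
  exact Finset.prod_le_prod' fun i _ => truncation_le _ _ _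

lemma tendsto_productMeasure_truncation {n : ℕ} {f : Fin n → ℝ → ℝ≥0}
    (hf : ∀ i, RadiallyDecreasing (f i)) {S : Set (Fin n → ℝ)} (hS : MeasurableSet S) :
    Filter.Tendsto (fun M => productMeasure (fun i => truncation (f i) M) S) Filter.atTop
      (nhds (productMeasure f S)) := by
  simp only [productMeasure_eq_withDensity fun i => (hf i).measurable,
    fun M => productMeasure_eq_withDensity fun i => ((hf i).truncation M).measurable,
    withDensity_apply _ hS]
  refine lintegral_tendsto_of_tendsto_of_monotone
    (fun M => (measurable_productDensity fun i =>
      ((hf i).truncation M).measurable).coe_nnreal_ennreal.aemeasurable)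
    (.of_forall fun x M N hMN => ENNReal.coe_le_coe.2 ?_) (.of_forall fun x => ?_)
  · exact Finset.prod_le_prod' fun i _ => truncation_mono _ _ hMN
  · refine tendsto_const_nhds.congr' ?_
    filter_upwards [Filter.eventually_all.2 fun i => eventually_truncation_eq (f i) (x i)]
      with M hM
    simp only [productDensity, hM]

/-! ### The linear inequality -/

/-- The smallest weakly unconditional set containing `C`. -/
def weaklyUnconditionalHull {n : ℕ} (C : Set (Fin n → ℝ)) : Set (Fin n → ℝ) :=
  ⋃ σ : Fin n → Bool, (fun (x : Fin n → ℝ) i => if σ i then x i else 0) '' C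

lemma subset_weaklyUnconditionalHull {n : ℕ} (C : Set (Fin n → ℝ)) :
    C ⊆ weaklyUnconditionalHull C := fun x hx =>
  Set.mem_iUnion.2 ⟨fun _ => true, x, hx, by simp⟩

lemma weaklyUnconditionalHull_subset {n : ℕ} {C A : Set (Fin n → ℝ)} (hCA : C ⊆ A)
    (hA : WeaklyUnconditional A) : weaklyUnconditionalHull C ⊆ A := by
  refine Set.iUnion_subset fun σ => ?_
  rintro _ ⟨x, hx, rfl⟩
  convert hA x (hCA hx) (fun i => if σ i then 1 else 0) (fun i => by cases σ i <;> simp) using 1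
  ext i
  cases h : σ i <;> simp [h]

lemma weaklyUnconditional_hull {n : ℕ} (C : Set (Fin n → ℝ)) :
    WeaklyUnconditional (weaklyUnconditionalHull C) := by
  intro x hx ε hε
  obtain ⟨σ, y, hy, rfl⟩ := Set.mem_iUnion.1 hx
  refine Set.mem_iUnion.2 ⟨fun i => σ i && decide (ε i = 1), y, hy, ?_⟩
  ext i
  rcases hε i with h | h <;> simp [h]

lemma IsCompact.weaklyUnconditionalHull {n : ℕ} {C : Set (Fin n → ℝ)} (hC : IsCompact C) :
    IsCompact (weaklyUnconditionalHull C) := by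
  refine isCompact_iUnion fun σ => hC.image (continuous_pi fun i => ?_)
  cases h : σ i
  · simpa [h] using continuous_const
  · simpa [h] using continuous_apply i

/-- The linear Brunn–Minkowski inequality, for weights of sum at most `1`. It follows from the case
of compact sets and finite measures by inner regularity and truncation of the densities; hence no
measurability of the combination is needed. -/
theorem productMeasure_smul_add_smul {n : ℕ} (hn : n ≠ 0) {f : Fin n → ℝ → ℝ≥0}
    (hf : ∀ i, RadiallyDecreasing (f i)) {K L : Set (Fin n → ℝ)}
    (hK : WeaklyUnconditional K) (hL : WeaklyUnconditional L)
    (hKm : NullMeasurableSet K volume) (hLm : NullMeasurableSet L volume)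
    (hK0 : productMeasure f K ≠ 0) (hL0 : productMeasure f L ≠ 0)
    {a b : ℝ} (ha : 0 ≤ a) (hb : 0 ≤ b) (hab : a + b ≤ 1) :
    ENNReal.ofReal a * productMeasure f K ^ (n⁻¹ : ℝ)
        + ENNReal.ofReal b * productMeasure f L ^ (n⁻¹ : ℝ)
      ≤ productMeasure f (a • K + b • L) ^ (n⁻¹ : ℝ) := by
  have hn' : (0 : ℝ) < n := by positivity
  have hac : productMeasure f ≪ volume := by
    rw [productMeasure_eq_withDensity fun i => (hf i).measurable]
    exact withDensity_absolutelyContinuous _ _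
  have hroot0 : ∀ {K}, productMeasure f K ≠ 0 → productMeasure f K ^ (n⁻¹ : ℝ) ≠ 0 := by
    intro K hK0 h
    rcases ENNReal.rpow_eq_zero_iff.1 h with h | h
    · exact hK0 h.1
    · linarith [h.2, inv_pos.2 hn']
  have hbetween : ∀ {K x}, productMeasure f K ≠ 0 →
      (x < productMeasure f K ^ (n⁻¹ : ℝ) ∨ x = 0) → ∃ r : ℝ, 0 < r ∧ x ≤ ENNReal.ofReal r ∧
        ENNReal.ofReal (r ^ n) < productMeasure f K := by
    intro K x hK0 hx
    have hx' : x < productMeasure f K ^ (n⁻¹ : ℝ) := by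
      rcases hx with hx | rfl
      · exact hx
      · exact pos_iff_ne_zero.2 (hroot0 hK0)
    obtain ⟨y, hxy, hy⟩ := exists_between hx'
    have hytop : y ≠ ∞ := ne_top_of_lt hy
    refine ⟨y.toReal, ENNReal.toReal_pos (ne_bot_of_gt hxy) hytop,
      by rw [ENNReal.ofReal_toReal hytop]; exact hxy.le, ?_⟩
    rw [ENNReal.ofReal_pow ENNReal.toReal_nonneg, ENNReal.ofReal_toReal hytop,
      ← ENNReal.rpow_natCast]
    exact (ENNReal.lt_rpow_inv_iff hn').1 hy
  have hsub : ∀ {K}, NullMeasurableSet K volume →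
      ∃ K' ⊆ K, MeasurableSet K' ∧ productMeasure f K' = productMeasure f K := by
    intro K hKm
    obtain ⟨K', hK', hK'm, hae⟩ := (hKm.mono_ac hac).exists_measurable_subset_ae_eq
    exact ⟨K', hK', hK'm, measure_congr hae⟩
  obtain ⟨K', hK'K, hK'm, hK'⟩ := hsub hKm
  obtain ⟨L', hL'L, hL'm, hL'⟩ := hsub hLm
  refine ENNReal.mul_add_mul_le_of_forall_lt ENNReal.ofReal_ne_top ENNReal.ofReal_ne_top
    fun x y hx hy => ?_
  obtain ⟨r, hr, hxr, hrK⟩ := hbetween hK0 hx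
  obtain ⟨s, hs, hys, hsL⟩ := hbetween hL0 hy
  rw [← hK'] at hrK
  rw [← hL'] at hsL
  obtain ⟨M, hMK, hML⟩ := (((tendsto_productMeasure_truncation hf hK'm).eventually
    (lt_mem_nhds hrK)).and ((tendsto_productMeasure_truncation hf hL'm).eventually
    (lt_mem_nhds hsL))).exists
  have hfin : IsFiniteMeasure (productMeasure fun i => truncation (f i) M) := by
    have : ∀ i, IsFiniteMeasure ((volume : Measure ℝ).withDensity
        fun x => (truncation (f i) M x : ℝ≥0∞)) :=
      fun i => isFiniteMeasure_withDensity (lintegral_truncation_ne_top _ _)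
    unfold productMeasure
    infer_instance
  obtain ⟨C, hCK, hC, hrC⟩ := hK'm.exists_lt_isCompact hMK
  obtain ⟨D, hDL, hD, hsD⟩ := hL'm.exists_lt_isCompact hML
  have key := (productMeasure_smul_add_smul_of_isCompact (fun i => (hf i).truncation M)
    (fun i => lintegral_truncation_ne_top _ _) hC.weaklyUnconditionalHull
    hD.weaklyUnconditionalHull (weaklyUnconditional_hull C) (weaklyUnconditional_hull D)
    ha hb hab hr hs (hrC.le.trans (measure_mono (subset_weaklyUnconditionalHull C)))
    (hsD.le.trans (measure_mono (subset_weaklyUnconditionalHull D)))).trans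
    ((productMeasure_truncation_le hf M _).trans (measure_mono (Set.add_subset_add
      (Set.smul_set_mono (weaklyUnconditionalHull_subset (hCK.trans hK'K) hK))
      (Set.smul_set_mono (weaklyUnconditionalHull_subset (hDL.trans hL'L) hL)))))
  calc ENNReal.ofReal a * x + ENNReal.ofReal b * y
      ≤ ENNReal.ofReal a * ENNReal.ofReal r + ENNReal.ofReal b * ENNReal.ofReal s := by gcongr
    _ = ENNReal.ofReal (a * r + b * s) := by
        rw [← ENNReal.ofReal_mul ha, ← ENNReal.ofReal_mul hb,
          ← ENNReal.ofReal_add (by positivity) (by positivity)]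
    _ ≤ _ := by
        rw [ENNReal.le_rpow_inv_iff hn', ENNReal.rpow_natCast, ← ENNReal.ofReal_pow (by positivity)]
        exact key

/-! ### The weights of the `p`-sum -/

/-- The factor `m ^ (1 / q) * c ^ (1 / p)`, with `q` the conjugate of `p`, by which a set is
dilated in the `p`-sum when its coefficient is `c` and its share of the parameter is `m`. -/
noncomputable def lpWeight (p c m : ℝ) : ℝ := m ^ (1 / p.conjExponent) * c ^ (1 / p)

lemma lpWeight_nonneg {p c m : ℝ} (hc : 0 ≤ c) (hm : 0 ≤ m) : 0 ≤ lpWeight p c m := by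
  unfold lpWeight; positivity

lemma lpWeight_pos {p c m : ℝ} (hc : 0 < c) (hm : 0 < m) : 0 < lpWeight p c m := by
  unfold lpWeight; positivity

lemma lpWeight_self {p c : ℝ} (hp : 1 < p) (hc : 0 < c) : lpWeight p c c = c := by
  have h := (Real.HolderConjugate.conjExponent hp).inv_add_inv_eq_one
  rw [lpWeight, ← Real.rpow_add hc, one_div, one_div, add_comm, h, Real.rpow_one]

lemma lpWeight_add_le_one {p lam μ : ℝ} (hp : 1 < p) (hlam : lam ∈ Set.Icc (0 : ℝ) 1)
    (hμ : μ ∈ Set.Icc (0 : ℝ) 1) : lpWeight p (1 - lam) (1 - μ) + lpWeight p lam μ ≤ 1 := by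
  have hpq := Real.HolderConjugate.conjExponent hp
  have h := hpq.inv_add_inv_eq_one
  have young : ∀ {c m : ℝ}, 0 ≤ c → 0 ≤ m →
      lpWeight p c m ≤ p.conjExponent⁻¹ * m + p⁻¹ * c := by
    intro c m hc hm
    simpa [lpWeight] using Real.geom_mean_le_arith_mean2_weighted
      (inv_nonneg.2 hpq.symm.nonneg) (inv_nonneg.2 hpq.nonneg) hm hc (by rw [add_comm, h])
  have h1 := young (sub_nonneg.2 hlam.2) (sub_nonneg.2 hμ.2)
  have h2 := young hlam.1 hμ.1
  linear_combination h1 + h2 + h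

/-- The parameter attaining equality in Hölder's inequality. When `x ≠ y`, the corresponding
weights have sum less than `1`, by strict concavity of `t ↦ t ^ (1 / q)`. -/
lemma exists_lpWeight_eq {p lam x y : ℝ} (hp : 1 < p) (hlam : lam ∈ Set.Ioo (0 : ℝ) 1)
    (hx : 0 ≤ x) (hy : 0 ≤ y) (hxy : x ≠ 0 ∨ y ≠ 0) :
    ∃ μ ∈ Set.Icc (0 : ℝ) 1,
      lpWeight p (1 - lam) (1 - μ) * x + lpWeight p lam μ * y
        = ((1 - lam) * x ^ p + lam * y ^ p) ^ (1 / p) ∧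
      (x ≠ y → lpWeight p (1 - lam) (1 - μ) + lpWeight p lam μ < 1) := by
  obtain ⟨hl0, hl1⟩ := hlam
  have hl1' : 0 < 1 - lam := sub_pos.2 hl1
  have hpq := Real.HolderConjugate.conjExponent hp
  set q := p.conjExponent with hq
  have hp0 : 0 < p := hpq.pos
  have hq0 : 0 < q := hpq.symm.pos
  have hsum : p⁻¹ + q⁻¹ = 1 := hpq.inv_add_inv_eq_one
  have hxp : 0 ≤ x ^ p := by positivity
  have hyp : 0 ≤ y ^ p := by positivity
  set D := (1 - lam) * x ^ p + lam * y ^ p with hD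
  have hD0 : 0 < D := by
    rcases hxy with h | h
    · have : 0 < x := hx.lt_of_ne' h
      positivity
    · have : 0 < y := hy.lt_of_ne' h
      positivity
  have hweight : ∀ {c t : ℝ}, 0 < c → 0 ≤ t →
      lpWeight p c (c * t ^ p / D) = c * (t ^ p) ^ (1 / q) / D ^ (1 / q) := by
    intro c t hc ht
    rw [lpWeight, ← hq, Real.div_rpow (by positivity) hD0.le, Real.mul_rpow hc.le (by positivity)]
    have : c ^ (1 / q) * c ^ (1 / p) = c := by
      rw [← Real.rpow_add hc, one_div, one_div, add_comm, hsum, Real.rpow_one]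
    linear_combination (t ^ p) ^ (1 / q) / D ^ (1 / q) * this
  have hpow : ∀ {t : ℝ}, 0 ≤ t → (t ^ p) ^ (1 / q) * t = t ^ p := by
    intro t ht
    rcases ht.eq_or_lt with rfl | ht
    · simp [hp0.ne']
    · rw [← Real.rpow_mul ht.le, ← Real.rpow_add_one ht.ne']
      congr 1
      field_simp at hsum ⊢
      linarith
  have h1μ : 1 - lam * y ^ p / D = (1 - lam) * x ^ p / D := by
    field_simp
    rw [hD]; ring
  have hw1 := hweight hl1' hx
  have hw2 := hweight hl0 hy
  refine ⟨lam * y ^ p / D, ⟨by positivity, ?_⟩, ?_, fun hne => ?_⟩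
  · rw [← sub_nonneg, h1μ]; positivity
  · rw [h1μ, hw1, hw2]
    have hDp : D ^ (1 / p) = D / D ^ (1 / q) := by
      rw [eq_div_iff (by positivity), ← Real.rpow_add hD0, one_div, one_div, hsum, Real.rpow_one]
    rw [hDp, div_mul_eq_mul_div, div_mul_eq_mul_div, ← add_div, mul_assoc, mul_assoc, hpow hx,
      hpow hy]
  · rw [h1μ, hw1, hw2, ← add_div, div_lt_one (by positivity)]
    have hq1 : 1 / q < 1 := by
      rw [one_div, ← hsum]
      linarith [inv_pos.2 hp0]
    have hne' : x ^ p ≠ y ^ p := fun h => hne ((Real.rpow_left_inj hx hy hp0.ne').1 h)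
    simpa using (Real.strictConcaveOn_rpow (by positivity) hq1).2 (Set.mem_Ici.2 hxp)
      (Set.mem_Ici.2 hyp) hne' hl1' hl0 (by ring)

lemma add_lt_lp_mean {p lam x y : ℝ} (hp : 1 < p) (hlam : lam ∈ Set.Ioo (0 : ℝ) 1)
    (hx : 0 ≤ x) (hy : 0 ≤ y) (hxy : x ≠ y) :
    (1 - lam) * x + lam * y < ((1 - lam) * x ^ p + lam * y ^ p) ^ (1 / p) := by
  have hl1' : 0 < 1 - lam := sub_pos.2 hlam.2
  have hl0 := hlam.1
  have h := (strictConvexOn_rpow hp).2 (Set.mem_Ici.2 hx) (Set.mem_Ici.2 hy) hxy hl1' hl0 (by ring)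
  simp only [smul_eq_mul] at h
  rw [one_div, Real.lt_rpow_inv_iff_of_pos (by positivity) (by positivity) (by linarith)]
  exact h

lemma mem_lpSum_lpSMul_iff {E : Type*} [AddCommGroup E] [Module ℝ E] {p lam : ℝ} {K L : Set E}
    {z : E} : z ∈ lpSum p (lpSMul p (1 - lam) K) (lpSMul p lam L) ↔
      ∃ μ ∈ Set.Icc (0 : ℝ) 1,
        z ∈ lpWeight p (1 - lam) (1 - μ) • K + lpWeight p lam μ • L := by
  constructor
  · rintro ⟨_, ⟨x, hx, rfl⟩, _, ⟨y, hy, rfl⟩, μ, hμ, rfl⟩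
    exact ⟨μ, hμ, _, ⟨x, hx, rfl⟩, _, ⟨y, hy, rfl⟩, by simp [lpWeight, mul_smul]⟩
  · rintro ⟨μ, hμ, _, ⟨x, hx, rfl⟩, _, ⟨y, hy, rfl⟩, rfl⟩
    exact ⟨_, ⟨x, hx, rfl⟩, _, ⟨y, hy, rfl⟩, μ, hμ, by simp [lpWeight, mul_smul]⟩

lemma smul_add_smul_subset_lpSum {E : Type*} [AddCommGroup E] [Module ℝ E] {p lam μ : ℝ}
    (K L : Set E) (hμ : μ ∈ Set.Icc (0 : ℝ) 1) :
    lpWeight p (1 - lam) (1 - μ) • K + lpWeight p lam μ • L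
      ⊆ lpSum p (lpSMul p (1 - lam) K) (lpSMul p lam L) :=
  fun _ hz => mem_lpSum_lpSMul_iff.2 ⟨μ, hμ, hz⟩

lemma combo_subset_lpSum {E : Type*} [AddCommGroup E] [Module ℝ E] {p lam : ℝ} (hp : 1 < p)
    (hlam : lam ∈ Set.Ioo (0 : ℝ) 1) (K L : Set E) :
    (1 - lam) • K + lam • L ⊆ lpSum p (lpSMul p (1 - lam) K) (lpSMul p lam L) := by
  have h := smul_add_smul_subset_lpSum (p := p) (lam := lam) K L (Set.Ioo_subset_Icc_self hlam)
  rwa [lpWeight_self hp (sub_pos.2 hlam.2), lpWeight_self hp hlam.1] at h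

/-- A convex set containing the origin also contains the `p`-combinations of its subsets. -/
lemma lpSum_subset_of_convex {E : Type*} [AddCommGroup E] [Module ℝ E] {p lam : ℝ} (hp : 1 < p)
    (hlam : lam ∈ Set.Ioo (0 : ℝ) 1) {K L C : Set E} (hC : Convex ℝ C) (h0 : (0 : E) ∈ C)
    (hK : K ⊆ C) (hL : L ⊆ C) : lpSum p (lpSMul p (1 - lam) K) (lpSMul p lam L) ⊆ C := by
  intro z hz
  obtain ⟨μ, hμ, _, ⟨x, hx, rfl⟩, _, ⟨y, hy, rfl⟩, rfl⟩ := mem_lpSum_lpSMul_iff.1 hz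
  exact hC.smul_add_smul_mem_of_zero_mem h0 (hK hx) (hL hy)
    (lpWeight_nonneg (sub_nonneg.2 hlam.2.le) (sub_nonneg.2 hμ.2))
    (lpWeight_nonneg hlam.1.le hμ.1) (lpWeight_add_le_one hp (Set.Ioo_subset_Icc_self hlam) hμ)

lemma lpSum_self_of_convex {E : Type*} [AddCommGroup E] [Module ℝ E] {p lam : ℝ} (hp : 1 < p)
    (hlam : lam ∈ Set.Ioo (0 : ℝ) 1) {K : Set E} (hK : Convex ℝ K) (h0 : (0 : E) ∈ K) :
    lpSum p (lpSMul p (1 - lam) K) (lpSMul p lam K) = K := by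
  refine (lpSum_subset_of_convex hp hlam hK h0 subset_rfl subset_rfl).antisymm fun x hx => ?_
  refine combo_subset_lpSum hp hlam K K ⟨_, ⟨x, hx, rfl⟩, _, ⟨x, hx, rfl⟩, ?_⟩
  simp [← add_smul]

/-! ### The inequality for the `p`-sum -/

lemma ENNReal.rpow_div_eq_rpow_inv_rpow (x : ℝ≥0∞) (p n : ℝ) : x ^ (p / n) = (x ^ n⁻¹) ^ p := by
  rw [← ENNReal.rpow_mul, div_eq_mul_inv, mul_comm]

lemma ENNReal.mul_ofReal_rpow_add {p lam x y : ℝ} (hp : 0 ≤ p) (hlam : lam ∈ Set.Ioo (0 : ℝ) 1)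
    (hx : 0 ≤ x) (hy : 0 ≤ y) :
    ENNReal.ofReal (1 - lam) * ENNReal.ofReal x ^ p + ENNReal.ofReal lam * ENNReal.ofReal y ^ p
      = ENNReal.ofReal ((1 - lam) * x ^ p + lam * y ^ p) := by
  have h1 : 0 ≤ 1 - lam := sub_nonneg.2 hlam.2.le
  have h2 := hlam.1.le
  rw [ENNReal.ofReal_rpow_of_nonneg hx hp, ENNReal.ofReal_rpow_of_nonneg hy hp,
    ← ENNReal.ofReal_mul h1, ← ENNReal.ofReal_mul h2,
    ← ENNReal.ofReal_add (by positivity) (by positivity)]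

/-- The linear inequality implies the inequality for the `p`-sum: choose the parameter attaining
equality in Hölder's inequality. -/
theorem productMeasure_lpSum {n : ℕ} (hn : n ≠ 0) {f : Fin n → ℝ → ℝ≥0}
    (hf : ∀ i, RadiallyDecreasing (f i)) {K L : Set (Fin n → ℝ)}
    (hK : WeaklyUnconditional K) (hL : WeaklyUnconditional L)
    (hKm : NullMeasurableSet K volume) (hLm : NullMeasurableSet L volume)
    (hK0 : productMeasure f K ≠ 0) (hL0 : productMeasure f L ≠ 0)
    {p lam : ℝ} (hp : 1 < p) (hlam : lam ∈ Set.Ioo (0 : ℝ) 1) :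
    ENNReal.ofReal (1 - lam) * productMeasure f K ^ (p / (n : ℝ))
        + ENNReal.ofReal lam * productMeasure f L ^ (p / (n : ℝ))
      ≤ productMeasure f (lpSum p (lpSMul p (1 - lam) K) (lpSMul p lam L)) ^ (p / (n : ℝ)) := by
  have hp0 : 0 < p := one_pos.trans hp
  have hn' : (0 : ℝ) < n := by positivity
  set S := lpSum p (lpSMul p (1 - lam) K) (lpSMul p lam L) with hS
  have key : ∀ {μ}, μ ∈ Set.Icc (0 : ℝ) 1 →
      ENNReal.ofReal (lpWeight p (1 - lam) (1 - μ)) * productMeasure f K ^ (n⁻¹ : ℝ)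
        + ENNReal.ofReal (lpWeight p lam μ) * productMeasure f L ^ (n⁻¹ : ℝ)
      ≤ productMeasure f S ^ (n⁻¹ : ℝ) := fun {μ} hμ =>
    (productMeasure_smul_add_smul hn hf hK hL hKm hLm hK0 hL0
      (lpWeight_nonneg (sub_nonneg.2 hlam.2.le) (sub_nonneg.2 hμ.2))
      (lpWeight_nonneg hlam.1.le hμ.1)
      (lpWeight_add_le_one hp (Set.Ioo_subset_Icc_self hlam) hμ)).trans
      (ENNReal.rpow_le_rpow (measure_mono (smul_add_smul_subset_lpSum K L hμ))
        (inv_nonneg.2 hn'.le))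
  simp only [ENNReal.rpow_div_eq_rpow_inv_rpow _ p (n : ℝ)]
  have hroot0 : ∀ {A}, productMeasure f A ≠ 0 → productMeasure f A ^ (n⁻¹ : ℝ) ≠ 0 := by
    intro A hA h
    rcases ENNReal.rpow_eq_zero_iff.1 h with h | h
    · exact hA h.1
    · linarith [h.2, inv_pos.2 hn']
  have hX0 := hroot0 hK0
  set X := productMeasure f K ^ (n⁻¹ : ℝ)
  set Y := productMeasure f L ^ (n⁻¹ : ℝ)
  by_cases htop : X = ∞ ∨ Y = ∞
  · have h := key (Set.Ioo_subset_Icc_self hlam)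
    rw [lpWeight_self hp (sub_pos.2 hlam.2), lpWeight_self hp hlam.1] at h
    have htop' : ENNReal.ofReal (1 - lam) * X + ENNReal.ofReal lam * Y = ∞ := by
      rcases htop with h | h
      · simp [h, hlam.2, ENNReal.mul_top]
      · simp [h, hlam.1, ENNReal.mul_top]
    rw [htop', top_le_iff] at h
    rw [h, ENNReal.top_rpow_of_pos hp0]
    exact le_top
  · push Not at htop
    obtain ⟨μ, hμ, heq, -⟩ := exists_lpWeight_eq (x := X.toReal) (y := Y.toReal) hp hlam
      ENNReal.toReal_nonneg ENNReal.toReal_nonneg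
      (Or.inl (ENNReal.toReal_ne_zero.2 ⟨hX0, htop.1⟩))
    have h := key hμ
    have hw1 := lpWeight_nonneg (p := p) (sub_nonneg.2 hlam.2.le) (sub_nonneg.2 hμ.2)
    have hw2 := lpWeight_nonneg (p := p) hlam.1.le hμ.1
    have hX := ENNReal.ofReal_toReal htop.1
    have hY := ENNReal.ofReal_toReal htop.2
    have hx : 0 ≤ X.toReal := ENNReal.toReal_nonneg
    have hy : 0 ≤ Y.toReal := ENNReal.toReal_nonneg
    have hl := hlam.1
    have hl' : 0 < 1 - lam := sub_pos.2 hlam.2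
    rw [← hX, ← hY, ← ENNReal.ofReal_mul hw1, ← ENNReal.ofReal_mul hw2,
      ← ENNReal.ofReal_add (by positivity) (by positivity), heq, one_div,
      ← ENNReal.ofReal_rpow_of_nonneg (by positivity) (by positivity),
      ENNReal.rpow_inv_le_iff hp0] at h
    rwa [← hX, ← hY, ENNReal.mul_ofReal_rpow_add hp0.le hlam hx hy]

/-! ### The equality case -/

lemma productDensity_pos_iff {n : ℕ} {f : Fin n → ℝ → ℝ≥0} {x : Fin n → ℝ} :
    0 < productDensity f x ↔ ∀ i, 0 < f i (x i) := by
  simp [productDensity, pos_iff_ne_zero, Finset.prod_ne_zero_iff]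

lemma convex_support_productDensity {n : ℕ} {f : Fin n → ℝ → ℝ≥0}
    (hsupp : ∀ i, Convex ℝ {x : ℝ | 0 < f i x}) : Convex ℝ {x | 0 < productDensity f x} := by
  have h : {x | 0 < productDensity f x} = Set.univ.pi fun i => {x | 0 < f i x} := by
    ext x
    simp [productDensity_pos_iff]
  rw [h]
  exact convex_pi fun i _ => hsupp i

lemma radiallyDecreasing_productDensity {n : ℕ} {f : Fin n → ℝ → ℝ≥0}
    (hf : ∀ i, RadiallyDecreasing (f i)) : RadiallyDecreasing (productDensity f) :=
  fun x t ht => Finset.prod_le_prod' fun i _ => hf i (x i) t ht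

/-- Dilating towards the origin a subset of the support strictly increases its measure relative
to its volume, if the density is strictly radially decreasing. -/
lemma mul_productMeasure_lt_productMeasure_smul {n : ℕ} (hn : n ≠ 0) {f : Fin n → ℝ → ℝ≥0}
    (hf : ∀ i, RadiallyDecreasing (f i))
    (hstrict : StrictlyRadiallyDecreasingOnSupport (productDensity f))
    {M : Set (Fin n → ℝ)} (hM : MeasurableSet M) (hMsupp : M ⊆ {x | 0 < productDensity f x})
    (hM0 : productMeasure f M ≠ 0) {c : ℝ} (hc0 : 0 < c) (hc1 : c < 1)
    (hfin : productMeasure f (c • M) ≠ ∞) :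
    ENNReal.ofReal (c ^ n) * productMeasure f M < productMeasure f (c • M) := by
  have : NeZero n := ⟨hn⟩
  have hdens := productMeasure_eq_withDensity fun i => (hf i).measurable
  have hmeas : Measurable (productDensity f) :=
    measurable_productDensity fun i => (hf i).measurable
  have hcM : MeasurableSet (c • M) := hM.const_smul₀ c
  have hrad := radiallyDecreasing_productDensity hf
  have hcn : 0 < c ^ n := by positivity
  have hle : ∀ x, productDensity f x ≤ productDensity f (c • x) := by
    intro x
    have := hrad (c • x) c⁻¹ ((one_le_inv₀ hc0).2 hc1.le)
    rwa [inv_smul_smul₀ hc0.ne'] at this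
  have hlt : ∀ x ∈ M, x ≠ 0 → productDensity f x < productDensity f (c • x) := by
    intro x hx hx0
    have hpos : 0 < productDensity f x := hMsupp hx
    have := hstrict (c • x) c⁻¹ (smul_ne_zero hc0.ne' hx0) ((one_lt_inv₀ hc0).2 hc1)
      (hpos.trans_le (hle x)) (by rwa [inv_smul_smul₀ hc0.ne'])
    rwa [inv_smul_smul₀ hc0.ne'] at this
  have hchange : productMeasure f (c • M)
      = ENNReal.ofReal (c ^ n) * ∫⁻ x in M, (productDensity f (c • x) : ℝ≥0∞) := by
    have h1 : ∫⁻ x in M, (productDensity f (c • x) : ℝ≥0∞)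
        = ENNReal.ofReal (c ^ n)⁻¹ * productMeasure f (c • M) := by
      calc ∫⁻ x in M, (productDensity f (c • x) : ℝ≥0∞)
          = ∫⁻ x, (c • M).indicator (fun y => (productDensity f y : ℝ≥0∞)) (c • x) := by
            rw [← lintegral_indicator hM]
            refine lintegral_congr fun x => ?_
            by_cases hx : x ∈ M
            · rw [Set.indicator_of_mem hx, Set.indicator_of_mem (Set.smul_mem_smul_set hx)]
            · rw [Set.indicator_of_notMem hx, Set.indicator_of_notMem]
              rwa [Set.smul_mem_smul_set_iff₀ hc0.ne']
        _ = ∫⁻ y, (c • M).indicator (fun y => (productDensity f y : ℝ≥0∞)) y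
              ∂(volume.map (c • ·)) :=
            (lintegral_map (hmeas.coe_nnreal_ennreal.indicator hcM)
              (measurable_const_smul c)).symm
        _ = _ := by
            rw [Measure.map_addHaar_smul _ hc0.ne', lintegral_smul_measure,
              lintegral_indicator hcM, hdens, withDensity_apply _ hcM]
            simp [abs_of_pos hc0]
    rw [h1, ← mul_assoc, ← ENNReal.ofReal_mul hcn.le, mul_inv_cancel₀ hcn.ne',
      ENNReal.ofReal_one, one_mul]
  have hcn' : ENNReal.ofReal (c ^ n) ≠ 0 := by simpa using hcn
  rw [hchange] at hfin ⊢
  refine (ENNReal.mul_lt_mul_iff_right hcn' ENNReal.ofReal_ne_top).2 ?_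
  have hfin' : ∫⁻ x in M, (productDensity f (c • x) : ℝ≥0∞) ≠ ∞ :=
    fun h => hfin (by rw [h, ENNReal.mul_top hcn'])
  rw [hdens, withDensity_apply _ hM]
  refine setLIntegral_strict_mono hM ?_ (hmeas.comp (measurable_const_smul c)).coe_nnreal_ennreal
    (ne_top_of_le_ne_top hfin' (lintegral_mono fun x => ENNReal.coe_le_coe.2 (hle x))) ?_
  · intro h
    rw [hdens] at hM0
    exact hM0 (withDensity_absolutelyContinuous _ _ h)
  · filter_upwards [compl_mem_ae_iff.2 (measure_singleton (0 : Fin n → ℝ))] with x hx0 hxM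
    exact ENNReal.coe_lt_coe.2 (hlt x hxM hx0)

/-- A convex set of positive volume that is not contained in a closed set exceeds it by a set
of positive volume, since its interior is dense in it. -/
lemma Convex.volume_sdiff_ne_zero {n : ℕ} {A N : Set (Fin n → ℝ)} (hA : Convex ℝ A)
    (hA0 : volume A ≠ 0) (hN : IsClosed N) (hAN : ¬ A ⊆ N) : volume (A \ N) ≠ 0 := by
  obtain ⟨z, hzA, hzN⟩ := Set.not_subset.1 hAN
  have hint : (interior A).Nonempty := by
    by_contra h
    rw [Set.not_nonempty_iff_eq_empty] at h
    refine hA0 (measure_mono_null ?_ (hA.addHaar_frontier volume))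
    rw [frontier, h, Set.sdiff_empty]
    exact subset_closure
  have hz : z ∈ closure (interior A) := by
    rw [hA.closure_interior_eq_closure_of_nonempty_interior hint]
    exact subset_closure hzA
  have hne : (Nᶜ ∩ interior A).Nonempty := mem_closure_iff.1 hz _ hN.isOpen_compl hzN
  refine ne_bot_of_gt (((hN.isOpen_compl.inter isOpen_interior).measure_pos volume hne).trans_le
    (measure_mono ?_))
  exact fun x hx => ⟨interior_subset hx.2, hx.1⟩

/-- A convex body contains every convex body with a smaller support function. -/
lemma subset_of_forall_isGreatest {n : ℕ} {K L : Set (Fin n → ℝ)} (hK : IsConvexBody K)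
    (hL : IsConvexBody L)
    (h : ∀ (φ : StrongDual ℝ (Fin n → ℝ)) (r s : ℝ), IsGreatest (φ '' K) r →
      IsGreatest (φ '' L) s → s ≤ r) : L ⊆ K := by
  intro y hy
  by_contra hyK
  obtain ⟨φ, u, hu, huy⟩ := geometric_hahn_banach_closed_point hK.2.2 hK.2.1.isClosed hyK
  obtain ⟨r, hr⟩ := (hK.2.1.image φ.continuous).exists_isGreatest (hK.1.image φ)
  obtain ⟨s, hs⟩ := (hL.2.1.image φ.continuous).exists_isGreatest (hL.1.image φ)
  obtain ⟨x, hx, rfl⟩ := hr.1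
  have h1 := h φ _ s hr hs
  have h2 := hs.2 (Set.mem_image_of_mem φ hy)
  linarith [hu x hx]

/-- If the Minkowski combination contains the whole `p`-sum, then the sets agree: their support
functions have equal arithmetic and `p`-th power means. -/
lemma eq_of_lpSum_subset {n : ℕ} {p lam : ℝ} (hp : 1 < p) (hlam : lam ∈ Set.Ioo (0 : ℝ) 1)
    {K L : Set (Fin n → ℝ)} (hK : IsConvexBody K) (hL : IsConvexBody L)
    (hK0 : (0 : Fin n → ℝ) ∈ K) (hL0 : (0 : Fin n → ℝ) ∈ L)
    (hsub : lpSum p (lpSMul p (1 - lam) K) (lpSMul p lam L) ⊆ (1 - lam) • K + lam • L) :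
    K = L := by
  have key : ∀ (φ : StrongDual ℝ (Fin n → ℝ)) (r s : ℝ), IsGreatest (φ '' K) r →
      IsGreatest (φ '' L) s → r = s := by
    intro φ r s hr hs
    by_contra hne
    have hr0 : 0 ≤ r := hr.2 ⟨0, hK0, map_zero φ⟩
    have hs0 : 0 ≤ s := hs.2 ⟨0, hL0, map_zero φ⟩
    have hrs : r ≠ 0 ∨ s ≠ 0 := by
      by_contra! h
      exact hne (h.1.trans h.2.symm)
    obtain ⟨μ, hμ, heq, -⟩ := exists_lpWeight_eq hp hlam hr0 hs0 hrs
    obtain ⟨x, hx, rfl⟩ := hr.1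
    obtain ⟨y, hy, rfl⟩ := hs.1
    have hz := hsub (smul_add_smul_subset_lpSum K L hμ
      (Set.add_mem_add (Set.smul_mem_smul_set hx) (Set.smul_mem_smul_set hy)))
    obtain ⟨_, ⟨k, hk, rfl⟩, _, ⟨l, hl, rfl⟩, hkl⟩ := hz
    have h1 := congrArg φ hkl
    simp only [map_add, map_smul, smul_eq_mul] at h1
    have h2 := add_lt_lp_mean hp hlam hr0 hs0 hne
    have h3 : (1 - lam) * φ k ≤ (1 - lam) * φ x :=
      mul_le_mul_of_nonneg_left (hr.2 ⟨k, hk, rfl⟩) (sub_nonneg.2 hlam.2.le)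
    have h4 : lam * φ l ≤ lam * φ y :=
      mul_le_mul_of_nonneg_left (hs.2 ⟨l, hl, rfl⟩) hlam.1.le
    linarith
  exact (subset_of_forall_isGreatest hL hK fun φ r s hr hs => (key φ s r hs hr).le).antisymm
    (subset_of_forall_isGreatest hK hL fun φ r s hr hs => (key φ r s hr hs).ge)

/-- Equality forces first the measures of the two sets to agree, by strictness of the dilation
inequality, and then the `p`-sum to lie in the Minkowski combination, by a comparison of
measures. -/
theorem eq_of_productMeasure_lpSum_eq {n : ℕ} (hn : n ≠ 0) {f : Fin n → ℝ → ℝ≥0}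
    (hf : ∀ i, RadiallyDecreasing (f i)) (hsupp : ∀ i, Convex ℝ {x : ℝ | 0 < f i x})
    {K L : Set (Fin n → ℝ)} (hK : WeaklyUnconditional K) (hL : WeaklyUnconditional L)
    (hK0 : productMeasure f K ≠ 0) (hL0 : productMeasure f L ≠ 0)
    {p lam : ℝ} (hp : 1 < p) (hlam : lam ∈ Set.Ioo (0 : ℝ) 1)
    (hKb : IsConvexBody K) (hLb : IsConvexBody L)
    (hKs : K ⊆ {x | 0 < productDensity f x}) (hLs : L ⊆ {x | 0 < productDensity f x})
    (hstrict : StrictlyRadiallyDecreasingOnSupport (productDensity f))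
    (hKfin : productMeasure f K ≠ ∞) (hLfin : productMeasure f L ≠ ∞)
    (heq : productMeasure f (lpSum p (lpSMul p (1 - lam) K) (lpSMul p lam L)) ^ (p / (n : ℝ))
      = ENNReal.ofReal (1 - lam) * productMeasure f K ^ (p / (n : ℝ))
        + ENNReal.ofReal lam * productMeasure f L ^ (p / (n : ℝ))) : K = L := by
  have hp0 : 0 < p := one_pos.trans hp
  have hn' : (0 : ℝ) < n := by positivity
  have hninv : (0 : ℝ) < (n : ℝ)⁻¹ := by positivity
  have hl0 : 0 < lam := hlam.1
  have hl1 : 0 < 1 - lam := sub_pos.2 hlam.2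
  have hlam' := Set.Ioo_subset_Icc_self hlam
  have hKz := hK.zero_mem hKb.1
  have hLz := hL.zero_mem hLb.1
  have hdens := productMeasure_eq_withDensity fun i => (hf i).measurable
  have hac : productMeasure f ≪ volume := by
    rw [hdens]; exact withDensity_absolutelyContinuous _ _
  have hsuppC := convex_support_productDensity hsupp
  set S := lpSum p (lpSMul p (1 - lam) K) (lpSMul p lam L) with hS
  have hSs : S ⊆ {x | 0 < productDensity f x} :=
    lpSum_subset_of_convex hp hlam hsuppC (hKs hKz) hKs hLs
  have hcomp : ∀ a b : ℝ, IsCompact (a • K + b • L) := fun a b =>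
    (hKb.2.1.smul a).add (hLb.2.1.smul b)
  have hconv : ∀ a b : ℝ, Convex ℝ (a • K + b • L) := fun a b =>
    (hKb.2.2.smul a).add (hLb.2.2.smul b)
  obtain ⟨x, hx, hX⟩ : ∃ x : ℝ, 0 < x ∧ productMeasure f K ^ (n⁻¹ : ℝ) = ENNReal.ofReal x := by
    have h := ENNReal.rpow_ne_top_of_nonneg hninv.le hKfin
    exact ⟨_, ENNReal.toReal_pos (ENNReal.rpow_pos (pos_iff_ne_zero.2 hK0) hKfin).ne' h,
      (ENNReal.ofReal_toReal h).symm⟩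
  obtain ⟨y, hy, hY⟩ : ∃ y : ℝ, 0 < y ∧ productMeasure f L ^ (n⁻¹ : ℝ) = ENNReal.ofReal y := by
    have h := ENNReal.rpow_ne_top_of_nonneg hninv.le hLfin
    exact ⟨_, ENNReal.toReal_pos (ENNReal.rpow_pos (pos_iff_ne_zero.2 hL0) hLfin).ne' h,
      (ENNReal.ofReal_toReal h).symm⟩
  have hlin : ∀ {a b : ℝ}, 0 ≤ a → 0 ≤ b → a + b ≤ 1 →
      ENNReal.ofReal (a * x + b * y) ≤ productMeasure f (a • K + b • L) ^ (n⁻¹ : ℝ) := by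
    intro a b ha hb hab
    have h := productMeasure_smul_add_smul hn hf hK hL hKb.2.1.measurableSet.nullMeasurableSet
      hLb.2.1.measurableSet.nullMeasurableSet hK0 hL0 ha hb hab
    rwa [hX, hY, ← ENNReal.ofReal_mul ha, ← ENNReal.ofReal_mul hb,
      ← ENNReal.ofReal_add (by positivity) (by positivity)] at h
  have hD : productMeasure f S ^ (n⁻¹ : ℝ)
      = ENNReal.ofReal (((1 - lam) * x ^ p + lam * y ^ p) ^ (1 / p)) := by
    simp only [ENNReal.rpow_div_eq_rpow_inv_rpow _ p (n : ℝ)] at heq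
    rw [hX, hY, ENNReal.mul_ofReal_rpow_add hp0.le hlam hx.le hy.le] at heq
    rw [← ENNReal.ofReal_rpow_of_nonneg (by positivity) (by positivity), ← heq,
      ← ENNReal.rpow_mul, mul_one_div_cancel hp0.ne', ENNReal.rpow_one]
  have hSfin : productMeasure f S ≠ ∞ := by
    intro h
    rw [h, ENNReal.top_rpow_of_pos hninv] at hD
    exact ENNReal.ofReal_ne_top hD.symm
  have hroot0 : ∀ {A} {r : ℝ}, 0 < r → ENNReal.ofReal r ≤ productMeasure f A ^ (n⁻¹ : ℝ) →
      productMeasure f A ≠ 0 := by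
    intro A r hr h h0
    rw [h0, ENNReal.zero_rpow_of_pos hninv, nonpos_iff_eq_zero, ENNReal.ofReal_eq_zero] at h
    linarith
  -- if `x ≠ y`, the optimal weights have sum `c < 1`, and the inequality is strict for `c • M`
  have hxy : x = y := by
    by_contra hne
    obtain ⟨μ, hμ, hμeq, hμlt⟩ := exists_lpWeight_eq hp hlam hx.le hy.le (Or.inl hx.ne')
    have hlt := hμlt hne
    have ha := lpWeight_nonneg (p := p) hl1.le (sub_nonneg.2 hμ.2)
    have hb := lpWeight_nonneg (p := p) hl0.le hμ.1
    have hsub := smul_add_smul_subset_lpSum (p := p) (lam := lam) K L hμ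
    set a := lpWeight p (1 - lam) (1 - μ)
    set b := lpWeight p lam μ
    have hDpos : 0 < ((1 - lam) * x ^ p + lam * y ^ p) ^ (1 / p) := by positivity
    set D := ((1 - lam) * x ^ p + lam * y ^ p) ^ (1 / p)
    have hc : 0 < a + b := by
      refine (add_nonneg ha hb).lt_of_ne fun h => ?_
      have h1 : a = 0 := by linarith
      have h2 : b = 0 := by linarith
      rw [h1, h2] at hμeq
      linarith
    set c := a + b with hcdef
    set M := (a / c) • K + (b / c) • L with hM
    have hcM : c • M = a • K + b • L := by
      rw [hM, smul_add, smul_smul, smul_smul, mul_div_cancel₀ _ hc.ne', mul_div_cancel₀ _ hc.ne']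
    have hsum : a / c + b / c = 1 := by rw [← add_div, ← hcdef, div_self hc.ne']
    have h1 := hlin (div_nonneg ha hc.le) (div_nonneg hb hc.le) hsum.le
    have hMD : a / c * x + b / c * y = D / c := by rw [← hμeq]; ring
    rw [hMD] at h1
    have hMs : M ⊆ {x | 0 < productDensity f x} := by
      rintro _ ⟨_, ⟨k, hk, rfl⟩, _, ⟨l, hl, rfl⟩, rfl⟩
      exact hsuppC (hKs hk) (hLs hl) (div_nonneg ha hc.le) (div_nonneg hb hc.le) hsum
    rw [← hcM] at hsub
    have h2 := mul_productMeasure_lt_productMeasure_smul hn hf hstrict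
      (hcomp _ _).measurableSet hMs (hroot0 (div_pos hDpos hc) h1) hc hlt
      (ne_top_of_le_ne_top hSfin (measure_mono hsub))
    have h3 := h2.trans_le (measure_mono hsub)
    have h4 := ENNReal.rpow_lt_rpow h3 hninv
    rw [hD, ENNReal.mul_rpow_of_nonneg _ _ hninv.le,
      ENNReal.ofReal_rpow_of_nonneg (by positivity) hninv.le,
      Real.pow_rpow_inv_natCast hc.le hn] at h4
    refine h4.not_ge ?_
    calc ENNReal.ofReal D = ENNReal.ofReal c * ENNReal.ofReal (D / c) := by
          rw [← ENNReal.ofReal_mul hc.le, mul_div_cancel₀ _ hc.ne']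
      _ ≤ _ := by gcongr
  subst hxy
  have hDx : ((1 - lam) * x ^ p + lam * x ^ p) ^ (1 / p) = x := by
    rw [← add_mul, sub_add_cancel, one_mul, ← Real.rpow_mul hx.le, mul_one_div_cancel hp0.ne',
      Real.rpow_one]
  rw [hDx] at hD
  set N := (1 - lam) • K + lam • L with hN
  have hNS : N ⊆ S := combo_subset_lpSum hp hlam K L
  have hSN : productMeasure f S ≤ productMeasure f N := by
    have h := hlin hl1.le hl0.le (by simp)
    rw [← add_mul, sub_add_cancel, one_mul, ← hD] at h
    exact (ENNReal.rpow_le_rpow_iff hninv).1 h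
  -- the `p`-sum has no more measure than `N`, so none of its convex pieces can leave `N`
  refine eq_of_lpSum_subset hp hlam hKb hLb hKz hLz fun z hz => ?_
  obtain ⟨μ, hμ, hz⟩ := mem_lpSum_lpSMul_iff.1 hz
  have hsub := smul_add_smul_subset_lpSum (p := p) (lam := lam) K L hμ
  have ha := lpWeight_nonneg (p := p) hl1.le (sub_nonneg.2 hμ.2)
  have hb := lpWeight_nonneg (p := p) hl0.le hμ.1
  have hab := lpWeight_add_le_one hp hlam' hμ
  have hpos : 0 < lpWeight p (1 - lam) (1 - μ) * x + lpWeight p lam μ * x := by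
    rcases hμ.1.eq_or_lt with h | h
    · have := lpWeight_pos (p := p) hl1 (show 0 < 1 - μ by linarith)
      positivity
    · have := lpWeight_pos (p := p) hl0 h
      positivity
  set P := lpWeight p (1 - lam) (1 - μ) • K + lpWeight p lam μ • L with hP
  have hP0 : volume P ≠ 0 := fun h => hroot0 hpos (hlin ha hb hab) (hac h)
  by_contra hzN
  have hdiff := Convex.volume_sdiff_ne_zero (hconv _ _) hP0 (hcomp (1 - lam) lam).isClosed
    fun h => hzN (h hz)
  have hdiffm : MeasurableSet (P \ N) := (hcomp _ _).measurableSet.diff (hcomp _ _).measurableSet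
  have hdiff' : productMeasure f (P \ N) ≠ 0 := by
    intro h
    rw [hdens, withDensity_apply_eq_zero
      (measurable_productDensity fun i => (hf i).measurable).coe_nnreal_ennreal] at h
    refine hdiff (measure_mono_null (t := _ ∩ (P \ N)) (fun w hw => Set.mem_inter ?_ hw) h)
    have : 0 < productDensity f w := hSs (hsub hw.1)
    exact ENNReal.coe_ne_zero.2 this.ne'
  have hle : productMeasure f N + productMeasure f (P \ N) ≤ productMeasure f N + 0 := by
    rw [← measure_union Set.disjoint_sdiff_right hdiffm, add_zero]
    exact (measure_mono (Set.union_subset hNS (Set.sdiff_subset.trans hsub))).trans hSN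
  have hNfin : productMeasure f N ≠ ∞ := ne_top_of_le_ne_top hSfin (measure_mono hNS)
  exact hdiff' (nonpos_iff_eq_zero.1 ((ENNReal.add_le_add_iff_left hNfin).1 hle))

theorem theoremt {n : ℕ} (hn : 1 ≤ n) (f : Fin n → ℝ → ℝ≥0)
    (hf : ∀ i, RadiallyDecreasing (f i))
    (hsupp : ∀ i, Convex ℝ {x : ℝ | 0 < f i x})
    (K L : Set (Fin n → ℝ))
    (hK : WeaklyUnconditional K) (hL : WeaklyUnconditional L)
    (hKmeas : NullMeasurableSet K volume) (hLmeas : NullMeasurableSet L volume)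
    (hpos : 0 < productMeasure f K * productMeasure f L)
    (hcomb : ∀ a b : ℝ, 0 ≤ a → 0 ≤ b → a + b ≤ 1 → NullMeasurableSet (a • K + b • L) volume)
    (p : ℝ) (hp : 1 < p) (lam : ℝ) (hlam : lam ∈ Set.Ioo (0 : ℝ) 1)
    (hmeas : NullMeasurableSet (lpSum p (lpSMul p (1 - lam) K) (lpSMul p lam L)) volume) :
    ENNReal.ofReal (1 - lam) * productMeasure f K ^ (p / (n : ℝ))
        + ENNReal.ofReal lam * productMeasure f L ^ (p / (n : ℝ))
      ≤ productMeasure f (lpSum p (lpSMul p (1 - lam) K) (lpSMul p lam L)) ^ (p / (n : ℝ))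
    ∧ (IsConvexBody K → IsConvexBody L →
        K ⊆ {x | 0 < productDensity f x} → L ⊆ {x | 0 < productDensity f x} →
        StrictlyRadiallyDecreasingOnSupport (productDensity f) →
        productMeasure f K ≠ ∞ → productMeasure f L ≠ ∞ →
        (productMeasure f (lpSum p (lpSMul p (1 - lam) K) (lpSMul p lam L)) ^ (p / (n : ℝ))
            = ENNReal.ofReal (1 - lam) * productMeasure f K ^ (p / (n : ℝ))
              + ENNReal.ofReal lam * productMeasure f L ^ (p / (n : ℝ))
          ↔ K = L)) := by
  have hn0 : n ≠ 0 := Nat.one_le_iff_ne_zero.1 hn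
  obtain ⟨hK0, hL0⟩ := mul_ne_zero_iff.1 hpos.ne'
  refine ⟨productMeasure_lpSum hn0 hf hK hL hKmeas hLmeas hK0 hL0 hp hlam, ?_⟩
  intro hKb hLb hKs hLs hstrict hKfin hLfin
  refine ⟨eq_of_productMeasure_lpSum_eq hn0 hf hsupp hK hL hK0 hL0 hp hlam hKb hLb hKs hLs hstrict
    hKfin hLfin, ?_⟩
  rintro rfl
  rw [lpSum_self_of_convex hp hlam hKb.2.2 (hK.zero_mem hKb.1), ← add_mul,
    ← ENNReal.ofReal_add (sub_nonneg.2 hlam.2.le) hlam.1.le, sub_add_cancel, ENNReal.ofReal_one,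
    one_mul]
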